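/- Let $p$ be a prime, and let $V$ be a complete discrete valuation ring which is a faithfully flat $\mathbb{Z}_{(p)}$-algebra and whose ramification index $e$ over $\mathbb{Z}_{(p)}$ satisfies $e<p-1$. Let $R$ be a regular (in particular noetherian) commutative $V$-algebra which is formally smooth over $V$, in the sense that for every prime ideal $\mathfrak p$ of $R$ the local ring $R_{\mathfrak p}$, with its $\mathfrak p$-adic topology, is formally smooth over $V$; this holds in particular if $R$ is formally smooth over $V$ for the discrete topology. Let $C$ be a finite group acting on $R$ by $V$-algebra automorphisms. Say that $C$ acts freely on a ring $S$ on which it acts if for every prime ideal $\mathfrak p$ of $S$ the inertia group $\{g\in C : gx-x\in\mathfrak p \text{ for all } x\in S\}$ is trivial. Let $V_1$ be the discrete valuation ring obtained from $V$ by adjoining a primitive $p$-th root of unity $\zeta_p$, that is, the integral closure of $V$ in $K(\zeta_p)$, where $K=\operatorname{Frac}(V)$. Assume that $C$ acts freely on $R[1/p]$ (for the induced action), and that either (a) the order of $C$ is relatively prime to $p$, or (b) the order of $C$ is $p$ and the scheme $\operatorname{Spec}(R^C\otimes_V V_1)$ is locally factorial, i.e. all its local rings are unique factorization domains, where $R^C\subseteq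 R$ is the subring of elements fixed by $C$. Then $C$ acts freely on $R$. -/

import Mathlib

open scoped TensorProduct

universe u v

/-- The ideal `(p)` of `ℤ` is prime; this makes `ℤ_(p)` available as a localization. -/
instance instIsPrimeSpanNatPrime (p : ℕ) [hp : Fact p.Prime] :
    (Ideal.span {(p : ℤ)}).IsPrime :=
  (Ideal.span_singleton_prime (Int.natCast_ne_zero.mpr hp.out.ne_zero)).mpr
    (Nat.prime_iff_prime_int.mp hp.out)

/-- The ring `ℤ_(p)`, the localization of `ℤ` at the prime ideal `(p)`. -/
abbrev ZLocalizedAt (p : ℕ) [Fact p.Prime] : Type :=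
  Localization.AtPrime (Ideal.span {(p : ℤ)})

/-- The group `C` acts freely on (the spectrum of) `S`: the inertia group
`{g ∈ C | g • x - x ∈ 𝔭 for all x ∈ S}` of every prime `𝔭` of `S` is trivial. Equivalently, `C`
acts freely on the set of ring homomorphisms from `S` to any field. -/
def ActsFreely (C : Type*) (S : Type*) [Group C] [CommRing S] [MulSemiringAction C S] : Prop :=
  ∀ 𝔭 : Ideal S, 𝔭.IsPrime → 𝔭.inertia C = ⊥

section AwayAction

variable (C : Type*) (R : Type*) [Group C] [CommRing R] [MulSemiringAction C R] (n : ℕ)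

theorem powers_natCast_le_comap (g : C) :
    Submonoid.powers (n : R) ≤
      (Submonoid.powers (n : R)).comap (MulSemiringAction.toRingHom C R g) := by
  rintro _ ⟨k, rfl⟩
  exact ⟨k, by
    change (n : R) ^ k = MulSemiringAction.toRingHom C R g ((n : R) ^ k)
    rw [map_pow, map_natCast]⟩

/-- The action of `C` on `R[1/n]` induced by an action of `C` on `R`. -/
@[reducible]
noncomputable def awayAction : MulSemiringAction C (Localization.Away (n : R)) where
  smul g x := IsLocalization.map (Localization.Away (n : R))
    (MulSemiringAction.toRingHom C R g) (powers_natCast_le_comap C R n g) x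
  one_smul x := by
    change IsLocalization.map _ _ (powers_natCast_le_comap C R n 1) x = x
    obtain ⟨r, s, rfl⟩ := IsLocalization.exists_mk'_eq (Submonoid.powers (n : R)) x
    rw [IsLocalization.map_mk']
    simp
  mul_smul g h x := by
    change IsLocalization.map _ _ (powers_natCast_le_comap C R n (g * h)) x =
      IsLocalization.map _ _ (powers_natCast_le_comap C R n g)
        (IsLocalization.map _ _ (powers_natCast_le_comap C R n h) x)
    obtain ⟨r, s, rfl⟩ := IsLocalization.exists_mk'_eq (Submonoid.powers (n : R)) x
    simp only [IsLocalization.map_mk']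
    simp [mul_smul]
  smul_zero g := map_zero (IsLocalization.map _ _ (powers_natCast_le_comap C R n g))
  smul_add g := map_add (IsLocalization.map _ _ (powers_natCast_le_comap C R n g))
  smul_one g := map_one (IsLocalization.map _ _ (powers_natCast_le_comap C R n g))
  smul_mul g := map_mul (IsLocalization.map _ _ (powers_natCast_le_comap C R n g))

end AwayAction

/-- The `A`-algebra `B`, endowed with the `I`-adic topology, is formally smooth over `A`:
every continuous `A`-algebra homomorphism from `B` to a quotient `E ⧸ N` of a discrete
`A`-algebra `E` by an ideal `N` of square zero lifts to a continuous homomorphism `B → E`.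
A homomorphism from `B` to a discrete ring is continuous if and only if it kills a power of `I`.
(Any test algebra may be replaced by the `A`-subalgebra generated by lifts of the elements of
`f(B)`, so test algebras in the universe `max u v` detect the same property as those of all
universes.) -/
def IsAdicallyFormallySmooth (A : Type u) (B : Type v) [CommRing A] [CommRing B] [Algebra A B]
    (I : Ideal B) : Prop :=
  ∀ (E : Type (max u v)) [CommRing E] [Algebra A E] (N : Ideal E), N ^ 2 = ⊥ →
    ∀ f : B →ₐ[A] E ⧸ N, (∃ m : ℕ, ∀ b ∈ I ^ m, f b = 0) →
      ∃ g : B →ₐ[A] E, (∃ m : ℕ, ∀ b ∈ I ^ m, g b = 0) ∧ (Ideal.Quotient.mkₐ A N).comp g = f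

/-- The `A`-algebra `B` is formally smooth at every point of its spectrum: each local ring
`B_𝔭`, with its `𝔭`-adic topology, is formally smooth over `A`. It holds if `B` is formally smooth
over `A` for the discrete topology, and also for power series rings over a complete discrete
valuation ring `A`. -/
def IsPointwiseFormallySmooth (A : Type u) (B : Type v) [CommRing A] [CommRing B]
    [Algebra A B] : Prop :=
  ∀ (𝔭 : Ideal B) [𝔭.IsPrime],
    IsAdicallyFormallySmooth A (Localization.AtPrime 𝔭)
      (IsLocalRing.maximalIdeal (Localization.AtPrime 𝔭))

/-- The affine scheme `Spec A` is locally factorial: all its local rings are unique factorization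
domains. -/
def IsLocallyFactorial (A : Type*) [CommRing A] : Prop :=
  ∀ (𝔭 : Ideal A) [𝔭.IsPrime],
    IsDomain (Localization.AtPrime 𝔭) ∧ UniqueFactorizationMonoid (Localization.AtPrime 𝔭)

/-- For a complete discrete valuation ring `V` of characteristic zero with field of fractions `K`,
the discrete valuation ring obtained from `V` by adjoining a primitive `p`-th root of unity `ζ`:
the integral closure of `V` in `K(ζ)`. -/
noncomputable abbrev AdjoinRootOfUnity (V : Type*) [CommRing V] [IsDomain V] (p : ℕ) :
    Subalgebra V (CyclotomicField p (FractionRing V)) :=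
  integralClosure V (CyclotomicField p (FractionRing V))

/-!
Suppose that `g ≠ 1` lies in the inertia group of a prime `𝔭` of `R`. Freeness on `R[1/p]` gives
`p ∈ 𝔭`. Write `π` for a uniformizer of `V`. Formal smoothness and regularity imply that, at every
prime containing `π`, the local ring and its quotient by `π` are regular
(`algebraMap_notMem_maximalIdeal_sq`, `isRegularLocalRing_quotient_span_singleton`); hence `π` is a
nonzerodivisor of `R` and `R / π` is reduced.

If the order of `g` is prime to `p`, formal smoothness lifts the residue map of `R_𝔭` successively to
homomorphisms `R_𝔭 → R_𝔭 / 𝔪 ^ j`, and averaging over the powers of `g` makes them `g`-invariant. They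
kill the ideal generated by all `g x - x` and send `p` to `p`. So no power of `p` lies in that ideal,
and the fixed locus of `g` meets `Spec R[1/p]`, which contradicts freeness
(`IsPointwiseFormallySmooth.exists_prime_forall_smul_sub_mem`).

If `C` has order `p`, let `W = V[ζ]`, let `S` be the localization of `R ⊗ W` at a prime above `𝔭`,
let `P` be the prime of `W` below it and `ϖ` a uniformizer at `P`. The ring of invariants of `g` on
`S` is a local ring of `Spec (R^C ⊗ W)`, hence factorial. Since `g` acts freely where `p ≠ 0`, the
Lagrange resolvents generate an ideal of `S` containing a power of `ϖ`, and since `W / P` is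
separable over the residue field of `V`, the ring `S / ϖ` is reduced. Dividing a resolvent by
primes of the ring of invariants yields a unit `y` with `g y = ζ y` (`exists_isUnit_eigenvector`).

A generator `σ` of the inertia group of `P` in the Galois group of `W / V` acts on `S`, commutes with
`g` and is the identity modulo `ϖ`. Let `σ ζ = ζ ^ (a + 1)` and `σ ϖ = θ ϖ`, and let `m` be the
valuation of `ζ - 1`. The condition `e < p - 1` says that `m` is smaller than the ramification index
of `P`, whence `θ ^ j ≠ a + 1` modulo `P` for `0 < j < m` (`exists_inertia_generator`). Comparing
`σ y` with `y ^ (a + 1)` then improves, step by step, a congruence `y ≡ c` modulo `ϖ ^ j` with `c`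
invariant under `g`, up to `j = m`. For `z = (y - c) / ϖ ^ m` the difference `g z - z` is a unit
multiple of `y` (`exists_isUnit_map_sub`), although `g` is the identity modulo the maximal ideal
of `S`.
-/

/-! ### Regular local rings -/

section RegularLocal

open IsLocalRing

/-- An element of `𝔪` outside `𝔪 ^ 2` can be exchanged for one element of a minimal system of
generators of `𝔪`, so killing it lowers the number of generators. -/
theorem spanFinrank_maximalIdeal_quotient_span_singleton_add_one_le {O : Type*} [CommRing O]
    [IsLocalRing O] [IsNoetherianRing O] {x : O} (hx : x ∈ maximalIdeal O)
    (hx2 : x ∉ maximalIdeal O ^ 2) [IsLocalRing (O ⧸ Ideal.span {x})] :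
    (maximalIdeal (O ⧸ Ideal.span {x})).spanFinrank + 1 ≤ (maximalIdeal O).spanFinrank := by
  classical
  obtain ⟨s, hcard, hspan⟩ := Submodule.FG.exists_span_finset_card_eq_spanFinrank
    (maximalIdeal O).fg_of_isNoetherianRing
  have hs : ∀ a ∈ s, a ∈ maximalIdeal O := fun a ha => hspan ▸ Submodule.subset_span ha
  have hxs : x ∈ Submodule.span O (s : Set O) := hspan ▸ hx
  obtain ⟨c, -, hc⟩ := Submodule.mem_span_finset.mp hxs
  obtain ⟨a, ha, hca⟩ : ∃ a ∈ s, c a ∉ maximalIdeal O := by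
    by_contra! h
    refine hx2 ?_
    rw [← hc, pow_two]
    exact Ideal.sum_mem _ fun a ha => Ideal.mul_mem_mul (h a ha) (hs a ha)
  obtain ⟨w, hw⟩ : IsUnit (c a) := by simpa using hca
  have hmk : (Ideal.Quotient.mk (Ideal.span {x})) x = 0 :=
    Ideal.Quotient.eq_zero_iff_mem.mpr (Ideal.mem_span_singleton_self x)
  have hmax : (maximalIdeal (O ⧸ Ideal.span {x})) =
      Submodule.span _ ((s.erase a).image (Ideal.Quotient.mk (Ideal.span {x})) : Set _) := by
    apply le_antisymm
    · intro y hy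
      obtain ⟨y, rfl⟩ := Ideal.Quotient.mk_surjective y
      have hy' : y ∈ maximalIdeal O := by
        rw [mem_maximalIdeal, mem_nonunits_iff] at hy ⊢
        exact fun h => hy (h.map _)
      rw [← hspan] at hy'
      have : Submodule.span O (s : Set O) ≤
          Ideal.comap (Ideal.Quotient.mk (Ideal.span {x})) (Ideal.span
            ((s.erase a).image (Ideal.Quotient.mk (Ideal.span {x})) : Set _)) := by
        rw [Submodule.span_le]
        have herase : ∀ b ∈ s.erase a, b ∈ Ideal.comap (Ideal.Quotient.mk (Ideal.span {x}))
            (Ideal.span ((s.erase a).image (Ideal.Quotient.mk (Ideal.span {x})) : Set _)) :=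
          fun b hb => Ideal.subset_span (
            Finset.mem_coe.mpr (Finset.mem_image_of_mem _ hb))
        intro b hb
        by_cases hba : b = a
        · subst hba
          have h1 : c b * b = x - ∑ i ∈ s.erase b, c i * i := by
            rw [← hc, ← Finset.add_sum_erase _ _ ha]
            simp [smul_eq_mul]
          have h2 : b = ↑w⁻¹ * (x - ∑ i ∈ s.erase b, c i * i) := by
            rw [← h1, ← hw, Units.inv_mul_cancel_left]
          rw [SetLike.mem_coe]
          suffices h3 : ↑w⁻¹ * (x - ∑ i ∈ s.erase b, c i * i) ∈ Ideal.comap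
              (Ideal.Quotient.mk (Ideal.span {x})) (Ideal.span
                ((s.erase b).image (Ideal.Quotient.mk (Ideal.span {x})) : Set _)) by
            rwa [← h2] at h3
          refine Ideal.mul_mem_left _ _ (Ideal.sub_mem _ ?_ (Ideal.sum_mem _ fun i hi =>
            Ideal.mul_mem_left _ _ (herase i hi)))
          rw [Ideal.mem_comap, hmk]
          exact Ideal.zero_mem _
        · exact herase b (Finset.mem_erase.mpr ⟨hba, hb⟩)
      exact this hy'
    · rw [Submodule.span_le]
      intro y hy
      simp only [Finset.coe_image, Set.mem_image, Finset.mem_coe] at hy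
      obtain ⟨b, hb, rfl⟩ := hy
      have hb' := hs b (Finset.mem_of_mem_erase hb)
      rw [SetLike.mem_coe, mem_maximalIdeal, mem_nonunits_iff]
      intro h
      obtain ⟨y, hy⟩ := Ideal.Quotient.mk_surjective (↑h.unit⁻¹ : O ⧸ Ideal.span {x})
      have h1 : Ideal.Quotient.mk (Ideal.span {x}) (1 - b * y) = 0 := by
        rw [map_sub, map_mul, hy, map_one, IsUnit.mul_val_inv, sub_self]
      rw [Ideal.Quotient.eq_zero_iff_mem] at h1
      have h2 : 1 - b * y ∈ maximalIdeal O :=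
        ((Ideal.span_singleton_le_iff_mem _).mpr hx) h1
      exact (maximalIdeal.isMaximal O).ne_top ((Ideal.eq_top_iff_one _).mpr
        (by simpa using Ideal.add_mem _ h2 (Ideal.mul_mem_right y _ hb')))
  rw [← hcard, hmax]
  have h1 := Submodule.spanFinrank_span_le_ncard_of_finite (R := O ⧸ Ideal.span {x})
    ((s.erase a).image (Ideal.Quotient.mk (Ideal.span {x}))).finite_toSet
  rw [Set.ncard_coe_finset] at h1
  have h2 := Finset.card_image_le (s := s.erase a) (f := Ideal.Quotient.mk (Ideal.span {x}))
  have h3 := Finset.card_erase_add_one ha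
  omega

theorem ringKrullDim_le_ringKrullDim_quotient_span_singleton_add_one {O : Type*} [CommRing O]
    [IsLocalRing O] [IsNoetherianRing O] {x : O} (hx : x ∈ maximalIdeal O) :
    ringKrullDim O ≤ ringKrullDim (O ⧸ Ideal.span {x}) + 1 := by
  simpa using ringKrullDim_le_ringKrullDim_quotient_add_encard ({x} : Set O)
    (by simpa [IsLocalRing.ringJacobson_eq_maximalIdeal] using hx)

theorem isRegularLocalRing_quotient_span_singleton {O : Type*} [CommRing O]
    [IsRegularLocalRing O] {x : O} (hx : x ∈ maximalIdeal O) (hx2 : x ∉ maximalIdeal O ^ 2) :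
    IsRegularLocalRing (O ⧸ Ideal.span {x}) := by
  have hne : Ideal.span {x} ≠ ⊤ := by
    rw [Ne, Ideal.span_singleton_eq_top]
    exact (mem_maximalIdeal x).mp hx
  have : Nontrivial (O ⧸ Ideal.span {x}) := Ideal.Quotient.nontrivial_iff.mpr hne
  have : IsLocalRing (O ⧸ Ideal.span {x}) :=
    IsLocalRing.of_surjective' _ Ideal.Quotient.mk_surjective
  apply IsRegularLocalRing.of_spanFinrank_maximalIdeal_le
  have h1 := spanFinrank_maximalIdeal_quotient_span_singleton_add_one_le hx hx2
  have h2 := ringKrullDim_le_ringKrullDim_quotient_span_singleton_add_one hx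
  rw [← IsRegularLocalRing.spanFinrank_maximalIdeal (R := O)] at h2
  have h3 : (((maximalIdeal (O ⧸ Ideal.span {x})).spanFinrank : WithBot ℕ∞) + 1) ≤
      ringKrullDim (O ⧸ Ideal.span {x}) + 1 := le_trans (by exact_mod_cast h1) h2
  cases h : ringKrullDim (O ⧸ Ideal.span {x}) with
  | bot => simp [h] at h3
  | coe n =>
    rw [h] at h3
    have h4 : ((maximalIdeal (O ⧸ Ideal.span {x})).spanFinrank : ℕ∞) + 1 ≤ n + 1 := by
      exact_mod_cast h3
    exact_mod_cast (ENat.add_le_add_iff_right ENat.one_ne_top).mp h4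

/-- Regular local rings are domains: `x ∈ 𝔪 \ 𝔪 ^ 2` chosen outside all minimal primes generates
a prime ideal by induction, and a minimal prime `𝔮 ⊆ (x)` satisfies `𝔮 = x𝔮`. -/
theorem IsRegularLocalRing.isDomain (O : Type*) [CommRing O] [IsRegularLocalRing O] :
    IsDomain O := by
  induction h : (maximalIdeal O).spanFinrank generalizing O with
  | zero =>
    rw [Submodule.spanFinrank_eq_zero_iff_eq_bot (maximalIdeal O).fg_of_isNoetherianRing] at h
    exact (isField_iff_maximalIdeal_eq.mpr h).isDomain
  | succ d ih =>
    have hm : maximalIdeal O ≠ ⊥ := by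
      intro h0
      rw [h0, Submodule.spanFinrank_bot] at h
      omega
    have hfin := minimalPrimes.finite_of_isNoetherianRing O
    have hdim : (maximalIdeal O).spanFinrank = ringKrullDim O :=
      IsRegularLocalRing.spanFinrank_maximalIdeal
    classical
    obtain ⟨x, hx, hx2, hxq⟩ : ∃ x ∈ maximalIdeal O, x ∉ maximalIdeal O ^ 2 ∧
        ∀ q ∈ minimalPrimes O, x ∉ q := by
      by_contra! hcon
      have hsub : (maximalIdeal O : Set O) ⊆
          ⋃ i ∈ ((insert (maximalIdeal O ^ 2) hfin.toFinset : Finset (Ideal O)) :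
            Set (Ideal O)), (i : Set O) := by
        intro x hx
        simp only [Finset.coe_insert, Set.Finite.coe_toFinset, Set.mem_iUnion, exists_prop]
        by_cases hx2 : x ∈ maximalIdeal O ^ 2
        · exact ⟨_, Set.mem_insert _ _, hx2⟩
        · obtain ⟨q, hq, hxq⟩ := hcon x hx hx2
          exact ⟨q, Set.mem_insert_of_mem _ hq, hxq⟩
      obtain ⟨i, hi, hle⟩ := (Ideal.subset_union_prime (f := fun i : Ideal O => i)
        (maximalIdeal O ^ 2) (maximalIdeal O ^ 2) (fun i hi h1 _ => by
          rcases Finset.mem_insert.mp hi with h2 | h2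
          · exact absurd h2 h1
          · exact (hfin.mem_toFinset.mp h2).1.1)).mp hsub
      rcases Finset.mem_insert.mp hi with rfl | hi
      · refine hm (Submodule.eq_bot_of_le_smul_of_le_jacobson_bot (maximalIdeal O) _
          (maximalIdeal O).fg_of_isNoetherianRing ?_ (maximalIdeal_le_jacobson _))
        rwa [smul_eq_mul, ← pow_two]
      · have hi' : i ∈ minimalPrimes O := hfin.mem_toFinset.mp hi
        have := hi'.1.1
        have hie : maximalIdeal O = i := le_antisymm hle (le_maximalIdeal this.ne_top)
        have h0 : (maximalIdeal O).height = 0 := by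
          rw [hie]
          exact Ideal.height_eq_zero_iff.mpr hi'
        rw [h, ← maximalIdeal_height_eq_ringKrullDim, h0] at hdim
        exact absurd hdim (by exact_mod_cast Nat.succ_ne_zero d)
    have := isRegularLocalRing_quotient_span_singleton hx hx2
    have hle := spanFinrank_maximalIdeal_quotient_span_singleton_add_one_le hx hx2
    have hge : d ≤ (maximalIdeal (O ⧸ Ideal.span {x})).spanFinrank := by
      have h1 := IsRegularLocalRing.spanFinrank_maximalIdeal (R := O ⧸ Ideal.span {x})
      have h2 := ringKrullDim_le_ringKrullDim_quotient_span_singleton_add_one hx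
      rw [← hdim, ← h1, h] at h2
      have h3 : d + 1 ≤ (maximalIdeal (O ⧸ Ideal.span {x})).spanFinrank + 1 := by
        exact_mod_cast h2
      omega
    have hdom : IsDomain (O ⧸ Ideal.span {x}) := ih _ (by omega)
    have hprime : (Ideal.span {x}).IsPrime := (Ideal.Quotient.isDomain_iff_prime _).mp hdom
    obtain ⟨q, hq, hqx⟩ := Ideal.exists_minimalPrimes_le (I := (⊥ : Ideal O)) (J := Ideal.span {x})
      bot_le
    have hqp : q.IsPrime := hq.1.1
    have hq0 : q = ⊥ := by
      refine Submodule.eq_bot_of_le_smul_of_le_jacobson_bot (maximalIdeal O) _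
          q.fg_of_isNoetherianRing ?_ (maximalIdeal_le_jacobson _)
      intro y hy
      obtain ⟨a, rfl⟩ := Ideal.mem_span_singleton.mp (hqx hy)
      have ha : a ∈ q := (hqp.mem_or_mem hy).resolve_left (hxq q hq)
      exact Ideal.mul_mem_mul hx ha
    rw [hq0] at hqp
    exact IsDomain.of_bot_isPrime O

end RegularLocal

/-! ### Flat lifts of field extensions over a discrete valuation ring -/

section FlatLift

open IsLocalRing Polynomial

variable {κ : Type v} [Field κ]

/-- The element `ϖ` of `E` is a nonzerodivisor which generates the kernel of `φ : E → κ`: thus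
`E` is a lift of the subring `φ(E)` of `κ` in which `ϖ` is regular. -/
structure IsRegularLift {E : Type u} [CommRing E] (ϖ : E) (φ : E →+* κ) : Prop where
  regular : ∀ a, ϖ * a = 0 → a = 0
  map_eq_zero_iff : ∀ a, φ a = 0 ↔ ϖ ∣ a

theorem IsRegularLift.not_sq_dvd {E : Type u} [CommRing E] {ϖ : E} {φ : E →+* κ}
    (h : IsRegularLift ϖ φ) : ¬ ϖ ^ 2 ∣ ϖ := by
  rintro ⟨c, hc⟩
  have h1 : ϖ * (1 - ϖ * c) = 0 := by linear_combination hc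
  have h2 := congrArg φ (h.regular _ h1)
  rw [map_sub, map_mul, map_one, (h.map_eq_zero_iff ϖ).mpr dvd_rfl] at h2
  simp at h2

/-- A regular lift can be made local by localizing at the kernel of `φ`. -/
theorem IsRegularLift.exists_isLocalRing {E : Type u} [CommRing E] {ϖ : E} {φ : E →+* κ}
    (h : IsRegularLift ϖ φ) :
    ∃ (E' : Type u) (_ : CommRing E') (i : E →+* E') (φ' : E' →+* κ),
      φ'.comp i = φ ∧ IsRegularLift (i ϖ) φ' ∧ IsLocalRing E' ∧ IsLocalHom φ' := by
  have : (RingHom.ker φ).IsPrime := RingHom.ker_isPrime φ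
  have hunit : ∀ y : (RingHom.ker φ).primeCompl, IsUnit (φ y) := fun y =>
    (show φ y ≠ 0 from y.2).isUnit
  refine ⟨Localization.AtPrime (RingHom.ker φ), inferInstance, algebraMap _ _,
    IsLocalization.lift (M := (RingHom.ker φ).primeCompl) hunit, IsLocalization.lift_comp _, ?_,
    inferInstance, ?_⟩
  · constructor
    · intro a ha
      obtain ⟨r, s, rfl⟩ := IsLocalization.exists_mk'_eq (RingHom.ker φ).primeCompl a
      rw [IsLocalization.mul_mk'_eq_mk'_of_mul, IsLocalization.mk'_eq_zero_iff] at ha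
      obtain ⟨m, hm⟩ := ha
      rw [IsLocalization.mk'_eq_zero_iff]
      exact ⟨m, h.regular _ (by rw [← hm]; ring)⟩
    · intro a
      obtain ⟨r, s, rfl⟩ := IsLocalization.exists_mk'_eq (RingHom.ker φ).primeCompl a
      constructor
      · intro ha
        rw [IsLocalization.lift_mk', Units.mul_left_eq_zero, h.map_eq_zero_iff] at ha
        obtain ⟨b, rfl⟩ := ha
        exact ⟨IsLocalization.mk' _ b s, (IsLocalization.mul_mk'_eq_mk'_of_mul _ _ _).symm⟩
      · rintro ⟨b, hb⟩
        rw [hb, map_mul, IsLocalization.lift_eq, (h.map_eq_zero_iff ϖ).mpr dvd_rfl, zero_mul]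
  · constructor
    intro a ha
    obtain ⟨r, s, rfl⟩ := IsLocalization.exists_mk'_eq (RingHom.ker φ).primeCompl a
    rw [IsLocalization.lift_mk', Units.isUnit_mul_units, isUnit_iff_ne_zero] at ha
    exact (IsLocalization.AtPrime.isUnit_mk'_iff _ (RingHom.ker φ) r s).mpr ha

/-- The image of a regular lift can be enlarged by any element `x` of the field: adjoin a root of
a monic lift of the minimal polynomial of `x`, or a variable if `x` is transcendental. -/
theorem IsRegularLift.exists_mem_range {E : Type u} [CommRing E] [IsLocalRing E] {ϖ : E}
    {φ : E →+* κ} [IsLocalHom φ] (h : IsRegularLift ϖ φ) (x : κ) :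
    ∃ (E' : Type u) (_ : CommRing E') (i : E →+* E') (φ' : E' →+* κ),
      φ'.comp i = φ ∧ IsRegularLift (i ϖ) φ' ∧ x ∈ φ'.range := by
  algebraize [ResidueField.lift φ]
  have hφ : (algebraMap (ResidueField E) κ).comp (residue E) = φ := ResidueField.lift_comp_residue φ
  have hdvd : ∀ f : E[X], f.map (residue E) = 0 → ∃ l, f = C ϖ * l := by
    intro f hf
    refine (C_dvd_iff_dvd_coeff _ _).mpr fun n => ?_
    rw [← h.map_eq_zero_iff, ← hφ, RingHom.comp_apply, ← coeff_map, hf]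
    simp
  have heval : ∀ f : E[X], eval₂ φ x f = aeval x (f.map (residue E)) := by
    intro f
    rw [aeval_def, eval₂_map, hφ]
  have hϖ : φ ϖ = 0 := (h.map_eq_zero_iff ϖ).mpr dvd_rfl
  by_cases hx : IsIntegral (ResidueField E) x
  · have hsurj : ∀ q : (ResidueField E)[X], q ∈ lifts (residue E) := fun q => by
      rw [lifts_iff_coeff_lifts]
      exact fun n => residue_surjective _
    obtain ⟨f, hf, -, hfm⟩ := lifts_and_natDegree_eq_and_monic (hsurj (minpoly _ x))
      (minpoly.monic hx)
    have hfx : eval₂ φ x f = 0 := by rw [heval, hf, minpoly.aeval]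
    refine ⟨AdjoinRoot f, inferInstance, AdjoinRoot.of f, AdjoinRoot.lift φ x hfx,
      AdjoinRoot.lift_comp_of _, ⟨?_, ?_⟩, ⟨AdjoinRoot.root f, AdjoinRoot.lift_root _⟩⟩
    · intro a ha
      obtain ⟨g, rfl⟩ := AdjoinRoot.mk_surjective a
      rw [← AdjoinRoot.mk_C, ← map_mul, AdjoinRoot.mk_eq_zero] at ha
      have h1 : f ∣ C ϖ * (g %ₘ f) := by
        rw [modByMonic_eq_sub_mul_div g, mul_sub]
        exact dvd_sub ha (Dvd.intro _ (by ring : f * (C ϖ * (g /ₘ f)) = _))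
      have h2 : C ϖ * (g %ₘ f) = 0 := by
        by_contra hne
        refine hfm.not_dvd_of_degree_lt hne (lt_of_le_of_lt ?_ (degree_modByMonic_lt g hfm)) h1
        rw [← smul_eq_C_mul]
        exact degree_smul_le _ _
      have h3 : g %ₘ f = 0 := by
        ext n
        exact h.regular _ (by rw [← coeff_C_mul, h2, coeff_zero])
      rw [AdjoinRoot.mk_eq_zero]
      exact (modByMonic_eq_zero_iff_dvd hfm).mp h3
    · intro a
      obtain ⟨g, rfl⟩ := AdjoinRoot.mk_surjective a
      rw [AdjoinRoot.lift_mk]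
      constructor
      · intro hg
        rw [heval] at hg
        obtain ⟨k, hk⟩ := minpoly.dvd _ _ hg
        obtain ⟨k, rfl⟩ := map_surjective _ residue_surjective k
        rw [← hf, ← Polynomial.map_mul] at hk
        obtain ⟨l, hl⟩ := hdvd (g - f * k) (by rw [Polynomial.map_sub, hk, sub_self])
        refine ⟨AdjoinRoot.mk f l, ?_⟩
        rw [← AdjoinRoot.mk_C, ← map_mul, ← hl]
        simp
      · rintro ⟨b, hb⟩
        obtain ⟨l, rfl⟩ := AdjoinRoot.mk_surjective b
        rw [← AdjoinRoot.lift_mk (h := hfx), hb, map_mul, AdjoinRoot.lift_of, hϖ, zero_mul]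
  · refine ⟨E[X], inferInstance, C, eval₂RingHom φ x, by ext; simp, ⟨?_, ?_⟩, ⟨X, by simp⟩⟩
    · intro a ha
      ext n
      exact h.regular _ (by rw [← coeff_C_mul, ha, coeff_zero])
    · intro g
      rw [coe_eval₂RingHom]
      constructor
      · intro hg
        rw [heval] at hg
        refine hdvd g ?_
        by_contra hne
        exact hx (isAlgebraic_iff_isIntegral.mp ⟨_, hne, hg⟩)
      · rintro ⟨b, rfl⟩
        simp [hϖ]

/-- There are regular lifts over `V` whose image in `κ` contains any given finite set. -/
theorem exists_isRegularLift_finset {V : Type u} [CommRing V] [IsDomain V]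
    [IsDiscreteValuationRing V] {ϖ : V} (hϖ : Irreducible ϖ) {ψ : V →+* κ} (hψ : ψ ϖ = 0)
    (s : Finset κ) :
    ∃ (E : Type u) (_ : CommRing E) (i : V →+* E) (φ : E →+* κ),
      φ.comp i = ψ ∧ IsRegularLift (i ϖ) φ ∧ ∀ x ∈ s, x ∈ φ.range := by
  classical
  induction s using Finset.induction_on with
  | empty =>
    refine ⟨V, inferInstance, RingHom.id V, ψ, by simp, ⟨?_, ?_⟩, by simp⟩
    · intro a ha
      exact (mul_eq_zero.mp ha).resolve_left hϖ.ne_zero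
    · intro a
      rw [RingHom.id_apply]
      constructor
      · intro ha
        by_contra hna
        rw [← Ideal.mem_span_singleton, ← hϖ.maximalIdeal_eq, mem_maximalIdeal,
          mem_nonunits_iff, not_not] at hna
        exact (hna.map ψ).ne_zero ha
      · rintro ⟨b, rfl⟩
        rw [map_mul, hψ, zero_mul]
  | insert x s hx ih =>
    obtain ⟨E, _, i, φ, hi, hE, hs⟩ := ih
    obtain ⟨E₁, _, i₁, φ₁, hi₁, hE₁, _, _⟩ := hE.exists_isLocalRing
    obtain ⟨E₂, _, i₂, φ₂, hi₂, hE₂, hx₂⟩ := hE₁.exists_mem_range x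
    refine ⟨E₂, _, i₂.comp (i₁.comp i), φ₂, ?_, hE₂, ?_⟩
    · rw [← RingHom.comp_assoc, hi₂, ← RingHom.comp_assoc, hi₁, hi]
    · intro y hy
      rcases Finset.mem_insert.mp hy with rfl | hy
      · exact hx₂
      · obtain ⟨z, rfl⟩ := hs y hy
        exact ⟨i₂ (i₁ z), by rw [← hi₁, ← hi₂]; rfl⟩

/-- In the polynomial ring over a discrete valuation ring with one variable for each element of an
extension `κ` of the residue field, the uniformizer does not lie in the square of the kernel of
the evaluation map onto `κ`. -/
theorem algebraMap_notMem_ker_aeval_sq {V : Type u} [CommRing V] [IsDomain V]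
    [IsDiscreteValuationRing V] [Algebra V κ] {ϖ : V} (hϖ : Irreducible ϖ)
    (hψ : algebraMap V κ ϖ = 0) :
    MvPolynomial.C ϖ ∉ RingHom.ker (MvPolynomial.aeval (R := V) (id : κ → κ)) ^ 2 := by
  classical
  set M := RingHom.ker (MvPolynomial.aeval (R := V) (id : κ → κ)) with hM
  -- An element of `M ^ 2` involves finitely many variables, so that it becomes divisible by
  -- `ϖ ^ 2` in a regular lift of a large enough finitely generated subfield of `κ`.
  have key : ∀ a ∈ M ^ 2, ∃ s : Finset κ, ∀ (E : Type u) [CommRing E] (i : V →+* E)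
      (φ : E →+* κ), φ.comp i = algebraMap V κ → IsRegularLift (i ϖ) φ →
      ∀ c : κ → E, (∀ x ∈ s, φ (c x) = x) → i ϖ ^ 2 ∣ MvPolynomial.eval₂Hom i c a := by
    intro a ha
    rw [pow_two] at ha
    induction ha using Submodule.mul_induction_on' with
    | mem_mul_mem f hf g hg =>
      refine ⟨f.vars ∪ g.vars, fun E _ i φ hi hE c hc => ?_⟩
      have aux : ∀ h : MvPolynomial κ V, h ∈ M → (∀ x ∈ h.vars, φ (c x) = x) →
          i ϖ ∣ MvPolynomial.eval₂Hom i c h := by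
        intro h hh hc
        rw [← hE.map_eq_zero_iff, ← RingHom.comp_apply, MvPolynomial.comp_eval₂Hom, hi]
        rw [hM, RingHom.mem_ker, MvPolynomial.aeval_def] at hh
        rw [← hh]
        exact MvPolynomial.eval₂Hom_congr' rfl (fun x hx _ => hc x hx) rfl
      rw [map_mul, pow_two]
      exact mul_dvd_mul (aux f hf fun x hx => hc x (Finset.mem_union_left _ hx))
        (aux g hg fun x hx => hc x (Finset.mem_union_right _ hx))
    | add a _ b _ iha ihb =>
      obtain ⟨s, hs⟩ := iha
      obtain ⟨t, ht⟩ := ihb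
      refine ⟨s ∪ t, fun E _ i φ hi hE c hc => ?_⟩
      rw [map_add]
      exact dvd_add (hs E i φ hi hE c fun x hx => hc x (Finset.mem_union_left _ hx))
        (ht E i φ hi hE c fun x hx => hc x (Finset.mem_union_right _ hx))
  intro hmem
  obtain ⟨s, hs⟩ := key _ hmem
  obtain ⟨E, _, i, φ, hi, hE, hr⟩ := exists_isRegularLift_finset hϖ hψ s
  choose! c hc using hr
  have := hs E i φ hi hE c hc
  rw [MvPolynomial.coe_eval₂Hom, MvPolynomial.eval₂_C] at this
  exact hE.not_sq_dvd this

/-- If `O` is a local `V`-algebra which is formally smooth for the topology defined by its maximal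
ideal, then the uniformizer of `V` is not in the square of the maximal ideal: the map of `O` onto
its residue field lifts to a square zero extension in which the uniformizer is nonzero. -/
theorem algebraMap_notMem_maximalIdeal_sq {V : Type u} [CommRing V] [IsDomain V]
    [IsDiscreteValuationRing V] {O : Type v} [CommRing O] [IsLocalRing O] [Algebra V O]
    (hO : IsAdicallyFormallySmooth V O (maximalIdeal O)) {ϖ : V} (hϖ : Irreducible ϖ)
    (hmem : algebraMap V O ϖ ∈ maximalIdeal O) :
    algebraMap V O ϖ ∉ maximalIdeal O ^ 2 := by
  intro hsq
  let ev := MvPolynomial.aeval (R := V) (id : ResidueField O → ResidueField O)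
  have hev : Function.Surjective ev := fun x => ⟨MvPolynomial.X x, by simp [ev]⟩
  have hψ : algebraMap V (ResidueField O) ϖ = 0 := by
    rw [IsScalarTower.algebraMap_apply V O]
    exact Ideal.Quotient.eq_zero_iff_mem.mpr hmem
  set M := RingHom.ker ev with hM
  let N : Ideal (MvPolynomial (ResidueField O) V ⧸ M ^ 2) := M.map (Ideal.Quotient.mk _)
  have hN : N ^ 2 = ⊥ := by
    rw [← Ideal.map_pow, Ideal.map_quotient_self]
  have hNker : N = RingHom.ker (Ideal.Quotient.liftₐ (M ^ 2) ev fun a ha =>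
      RingHom.mem_ker.mp (Ideal.pow_le_self two_ne_zero ha)) := by
    ext a
    obtain ⟨a, rfl⟩ := Ideal.Quotient.mk_surjective a
    rw [Ideal.mem_quotient_iff_mem (Ideal.pow_le_self two_ne_zero), RingHom.mem_ker]
    rfl
  let e : ((MvPolynomial (ResidueField O) V ⧸ M ^ 2) ⧸ N) ≃ₐ[V] ResidueField O :=
    (Ideal.quotientEquivAlgOfEq V hNker).trans
      (Ideal.quotientKerAlgEquivOfSurjective (fun x => by
        obtain ⟨y, rfl⟩ := hev x
        exact ⟨Ideal.Quotient.mk _ y, rfl⟩))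
  obtain ⟨g, -, hg⟩ := hO (MvPolynomial (ResidueField O) V ⧸ M ^ 2) N hN
    (e.symm.toAlgHom.comp (IsScalarTower.toAlgHom V O (ResidueField O)))
    ⟨1, fun b hb => by
      rw [pow_one] at hb
      simpa using hb⟩
  have hgm : maximalIdeal O ≤ N.comap g := by
    intro b hb
    have h2 : Ideal.Quotient.mk N (g b) = 0 := by
      rw [← Ideal.Quotient.mkₐ_eq_mk V, ← AlgHom.comp_apply, hg]
      simpa using hb
    rw [Ideal.mem_comap]
    exact Ideal.Quotient.eq_zero_iff_mem.mp h2
  have h0 : g (algebraMap V O ϖ) ∈ N ^ 2 :=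
    (Ideal.pow_right_mono hgm 2).trans (Ideal.le_comap_pow _ _) hsq
  rw [hN, Ideal.mem_bot, AlgHom.commutes] at h0
  refine algebraMap_notMem_ker_aeval_sq hϖ hψ (Ideal.Quotient.eq_zero_iff_mem.mp ?_)
  rw [← h0]
  rfl

end FlatLift

/-! ### The special fibre of a pointwise formally smooth regular algebra -/

section SpecialFibre

open IsLocalRing

variable {V : Type u} [CommRing V] [IsDomain V] [IsDiscreteValuationRing V]
  {R : Type v} [CommRing R] [Algebra V R]

theorem IsPointwiseFormallySmooth.algebraMap_localization_mem (hR : IsPointwiseFormallySmooth V R)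
    {ϖ : V} (hϖ : Irreducible ϖ) (𝔭 : Ideal R) [𝔭.IsPrime] (h : algebraMap V R ϖ ∈ 𝔭) :
    algebraMap V (Localization.AtPrime 𝔭) ϖ ∈ maximalIdeal (Localization.AtPrime 𝔭) ∧
      algebraMap V (Localization.AtPrime 𝔭) ϖ ∉ maximalIdeal (Localization.AtPrime 𝔭) ^ 2 := by
  have h1 : algebraMap V (Localization.AtPrime 𝔭) ϖ ∈ maximalIdeal (Localization.AtPrime 𝔭) := by
    rw [IsScalarTower.algebraMap_apply V R]
    exact (IsLocalization.AtPrime.to_map_mem_maximal_iff _ 𝔭 _).mpr h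
  exact ⟨h1, algebraMap_notMem_maximalIdeal_sq (hR 𝔭) hϖ h1⟩

theorem IsPointwiseFormallySmooth.algebraMap_localization_ne_zero
    (hR : IsPointwiseFormallySmooth V R) {ϖ : V} (hϖ : Irreducible ϖ) (𝔭 : Ideal R) [𝔭.IsPrime]
    (h : algebraMap V R ϖ ∈ 𝔭) : algebraMap V (Localization.AtPrime 𝔭) ϖ ≠ 0 := by
  intro h0
  have := (hR.algebraMap_localization_mem hϖ 𝔭 h).2
  rw [h0] at this
  exact this (Ideal.zero_mem _)

variable [IsRegularRing R]

theorem IsPointwiseFormallySmooth.eq_zero_of_algebraMap_mul_eq_zero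
    (hR : IsPointwiseFormallySmooth V R) {ϖ : V} (hϖ : Irreducible ϖ) {a : R}
    (ha : algebraMap V R ϖ * a = 0) : a = 0 := by
  by_contra hne
  have htop : Submodule.annihilator (Submodule.span R {a}) ≠ ⊤ := by
    intro h
    rw [Submodule.annihilator_eq_top_iff, Submodule.span_singleton_eq_bot] at h
    exact hne h
  obtain ⟨𝔭, hmax, hle⟩ := Ideal.exists_le_maximal _ htop
  have := hmax.isPrime
  have := IsRegularLocalRing.isDomain (Localization.AtPrime 𝔭)
  have hmem : algebraMap V R ϖ ∈ 𝔭 := hle (Submodule.mem_annihilator_span_singleton _ _ |>.mpr ha)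
  have h0 := hR.algebraMap_localization_ne_zero hϖ 𝔭 hmem
  have h1 : algebraMap R (Localization.AtPrime 𝔭) a = 0 := by
    have := congrArg (algebraMap R (Localization.AtPrime 𝔭)) ha
    rw [map_mul, map_zero, ← IsScalarTower.algebraMap_apply] at this
    exact (mul_eq_zero.mp this).resolve_left h0
  obtain ⟨s, hs⟩ := (IsLocalization.map_eq_zero_iff 𝔭.primeCompl _ _).mp h1
  exact s.2 (hle (Submodule.mem_annihilator_span_singleton _ _ |>.mpr hs))

theorem IsPointwiseFormallySmooth.isRadical_span_algebraMap (hR : IsPointwiseFormallySmooth V R)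
    {ϖ : V} (hϖ : Irreducible ϖ) : (Ideal.span {algebraMap V R ϖ}).IsRadical := by
  rintro x ⟨n, hn⟩
  by_contra hx
  have htop : (Ideal.span {algebraMap V R ϖ}).colon {x} ≠ ⊤ := by
    intro h
    have h1 : (1 : R) ∈ (Ideal.span {algebraMap V R ϖ}).colon {x} := h ▸ Submodule.mem_top
    rw [Submodule.mem_colon_singleton, one_smul] at h1
    exact hx h1
  obtain ⟨𝔭, hmax, hle⟩ := Ideal.exists_le_maximal _ htop
  have := hmax.isPrime
  have hmem : algebraMap V R ϖ ∈ 𝔭 := hle <| by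
    rw [Submodule.mem_colon_singleton]
    exact Ideal.mul_mem_right _ _ (Ideal.mem_span_singleton_self _)
  obtain ⟨h1, h2⟩ := hR.algebraMap_localization_mem hϖ 𝔭 hmem
  have := isRegularLocalRing_quotient_span_singleton h1 h2
  have := IsRegularLocalRing.isDomain
    (Localization.AtPrime 𝔭 ⧸ Ideal.span {algebraMap V (Localization.AtPrime 𝔭) ϖ})
  have hprime := (Ideal.Quotient.isDomain_iff_prime _).mp this
  have h3 : algebraMap R (Localization.AtPrime 𝔭) x ∈
      Ideal.span {algebraMap V (Localization.AtPrime 𝔭) ϖ} := by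
    refine hprime.mem_of_pow_mem n ?_
    have := Ideal.mem_map_of_mem (algebraMap R (Localization.AtPrime 𝔭)) hn
    rwa [Ideal.map_span, Set.image_singleton, ← IsScalarTower.algebraMap_apply, map_pow] at this
  rw [IsScalarTower.algebraMap_apply V R, ← Set.image_singleton, ← Ideal.map_span,
    IsLocalization.algebraMap_mem_map_algebraMap_iff 𝔭.primeCompl] at h3
  obtain ⟨s, hs, hsx⟩ := h3
  exact hs (hle (Submodule.mem_colon_singleton.mpr hsx))

end SpecialFibre

/-! ### Actions on localizations -/

section LocalAction

open IsLocalRing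

theorem ActsFreely.eq_one_of_forall_smul_sub_mem {C R : Type*} [Group C] [CommRing R]
    [MulSemiringAction C R] {n : ℕ}
    (hfree : letI := awayAction C R n
      ActsFreely C (Localization.Away (n : R)))
    {𝔮 : Ideal R} [𝔮.IsPrime] (hn : (n : R) ∉ 𝔮) {g : C} (hg : ∀ x : R, g • x - x ∈ 𝔮) :
    g = 1 := by
  let _ := awayAction C R n
  have hdisj : Disjoint (Submonoid.powers (n : R) : Set R) (𝔮 : Set R) := by
    rw [Set.disjoint_left]
    rintro _ ⟨k, rfl⟩ hk
    exact hn (Ideal.IsPrime.mem_of_pow_mem ‹_› k hk)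
  have hprime := IsLocalization.isPrime_of_isPrime_disjoint (Submonoid.powers (n : R))
    (Localization.Away (n : R)) 𝔮 inferInstance hdisj
  have hmem : g ∈ (𝔮.map (algebraMap R (Localization.Away (n : R)))).inertia C := by
    intro x
    obtain ⟨r, s, rfl⟩ := IsLocalization.exists_mk'_eq (Submonoid.powers (n : R)) x
    have hs : MulSemiringAction.toRingHom C R g s = s := by
      obtain ⟨_, k, rfl⟩ := s
      change MulSemiringAction.toRingHom C R g ((n : R) ^ k) = (n : R) ^ k
      rw [map_pow, map_natCast]
    have h1 : g • IsLocalization.mk' (Localization.Away (n : R)) r s =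
        IsLocalization.mk' (Localization.Away (n : R)) (g • r) s := by
      change IsLocalization.map _ _ (powers_natCast_le_comap C R n g) _ = _
      rw [IsLocalization.map_mk']
      congr 1
      exact Subtype.ext hs
    refine (Ideal.mul_unit_mem_iff_mem _
      (IsLocalization.map_units (Localization.Away (n : R)) s)).mp ?_
    rw [h1, sub_mul, IsLocalization.mk'_spec, IsLocalization.mk'_spec, ← map_sub]
    exact Ideal.mem_map_of_mem _ (hg r)
  rw [hfree _ hprime] at hmem
  exact Subgroup.mem_bot.mp hmem

variable {B : Type*} [CommRing B] (𝔓 : Ideal B)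

theorem eq_comap_of_forall_sub_mem (f : B →+* B) (hf : ∀ x, f x - x ∈ 𝔓) : 𝔓 = 𝔓.comap f := by
  ext x
  rw [Ideal.mem_comap, ← sub_add_cancel (f x) x, Ideal.add_mem_iff_right _ (hf x)]

variable [𝔓.IsPrime]

/-- The endomorphism of `B_𝔓` induced by an endomorphism of `B` which is the identity
modulo `𝔓`. -/
noncomputable def inertialMap (f : B →+* B) (hf : ∀ x, f x - x ∈ 𝔓) :
    Localization.AtPrime 𝔓 →+* Localization.AtPrime 𝔓 :=
  Localization.localRingHom 𝔓 𝔓 f (eq_comap_of_forall_sub_mem 𝔓 f hf)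

variable {𝔓} {f : B →+* B} (hf : ∀ x, f x - x ∈ 𝔓)

@[simp]
theorem inertialMap_algebraMap (x : B) :
    inertialMap 𝔓 f hf (algebraMap B _ x) = algebraMap B _ (f x) :=
  Localization.localRingHom_to_map _ _ _ _ _

/-- If `f` is the identity modulo an ideal `I ⊆ 𝔓`, then `f` induces the identity modulo `I` on
the localization at `𝔓`. -/
theorem inertialMap_sub_mem_map (I : Ideal B) (hI : ∀ x, f x - x ∈ I)
    (x : Localization.AtPrime 𝔓) :
    inertialMap 𝔓 f hf x - x ∈ I.map (algebraMap B (Localization.AtPrime 𝔓)) := by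
  obtain ⟨r, s, rfl⟩ := IsLocalization.exists_mk'_eq 𝔓.primeCompl x
  have hs : IsUnit (algebraMap B (Localization.AtPrime 𝔓) s) := IsLocalization.map_units _ s
  set y := IsLocalization.mk' (Localization.AtPrime 𝔓) r s with hy
  have hys : y * algebraMap B _ s = algebraMap B _ r := IsLocalization.mk'_spec _ _ _
  have h1 := congrArg (inertialMap 𝔓 f hf) hys
  rw [map_mul, inertialMap_algebraMap, inertialMap_algebraMap] at h1
  refine (Ideal.mul_unit_mem_iff_mem _ hs).mp ?_
  have h2 : (inertialMap 𝔓 f hf y - y) * algebraMap B _ s =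
      algebraMap B _ (f r - r) - inertialMap 𝔓 f hf y * algebraMap B _ (f s - s) := by
    rw [map_sub, map_sub, ← h1, ← hys]
    ring
  rw [h2]
  exact Ideal.sub_mem _ (Ideal.mem_map_of_mem _ (hI r))
    (Ideal.mul_mem_left _ _ (Ideal.mem_map_of_mem _ (hI s)))

theorem inertialMap_sub_mem_maximalIdeal (x : Localization.AtPrime 𝔓) :
    inertialMap 𝔓 f hf x - x ∈ maximalIdeal (Localization.AtPrime 𝔓) := by
  rw [← Localization.AtPrime.map_eq_maximalIdeal]
  exact inertialMap_sub_mem_map hf 𝔓 hf x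

theorem inertialMap_iterate_eq_self {n : ℕ} (hn : ∀ x, f^[n] x = x)
    (x : Localization.AtPrime 𝔓) : (inertialMap 𝔓 f hf)^[n] x = x := by
  have h : ((inertialMap 𝔓 f hf : Localization.AtPrime 𝔓 →+* Localization.AtPrime 𝔓) ^ n) =
      RingHom.id _ := by
    refine IsLocalization.ringHom_ext 𝔓.primeCompl (RingHom.ext fun b => ?_)
    rw [RingHom.comp_apply, RingHom.coe_pow, RingHom.comp_apply, RingHom.id_apply]
    have : ∀ k, (inertialMap 𝔓 f hf)^[k] (algebraMap B _ b) = algebraMap B _ (f^[k] b) := by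
      intro k
      induction k with
      | zero => rfl
      | succ k ih => rw [Function.iterate_succ_apply', ih, inertialMap_algebraMap,
          Function.iterate_succ_apply']
    rw [this, hn]
  rw [← RingHom.coe_pow, h, RingHom.id_apply]

end LocalAction

/-! ### Invariant lifts and automorphisms of order prime to `p` -/

section Tame

open IsLocalRing

/-- The lifting property along any surjection with kernel of square zero, for algebras in the
universe of `B`. -/
theorem IsAdicallyFormallySmooth.exists_lift {A : Type u} {B : Type v} [CommRing A] [CommRing B]
    [Algebra A B] {I : Ideal B} (hB : IsAdicallyFormallySmooth A B I) {E E' : Type v}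
    [CommRing E] [CommRing E'] [Algebra A E] [Algebra A E'] (q : E →ₐ[A] E')
    (hq : Function.Surjective q) (hker : RingHom.ker q ^ 2 = ⊥) (f : B →ₐ[A] E')
    (hf : ∃ m : ℕ, ∀ b ∈ I ^ m, f b = 0) :
    ∃ g : B →ₐ[A] E, (∃ m : ℕ, ∀ b ∈ I ^ m, g b = 0) ∧ q.comp g = f := by
  let q' : ULift.{u} E →ₐ[A] E' := q.comp ULift.algEquiv.toAlgHom
  have hq' : Function.Surjective q' := fun x => by
    obtain ⟨y, rfl⟩ := hq x
    exact ⟨⟨y⟩, rfl⟩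
  have hker' : RingHom.ker q' ^ 2 = ⊥ := by
    rw [pow_two, eq_bot_iff, Ideal.mul_le]
    intro a ha b hb
    have h1 : a.down * b.down ∈ RingHom.ker q ^ 2 := by
      rw [pow_two]
      exact Ideal.mul_mem_mul ha hb
    rw [hker, Ideal.mem_bot] at h1
    exact ULift.down_injective h1
  let e := Ideal.quotientKerAlgEquivOfSurjective hq'
  obtain ⟨g, ⟨m, hm⟩, hg⟩ := hB (ULift.{u} E) (RingHom.ker q') hker' (e.symm.toAlgHom.comp f) (by
    obtain ⟨m, hm⟩ := hf
    exact ⟨m, fun b hb => by simp [hm b hb]⟩)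
  refine ⟨ULift.algEquiv.toAlgHom.comp g, ⟨m, fun b hb => by simp [hm b hb]⟩, ?_⟩
  ext b
  have h1 := congrArg e (DFunLike.congr_fun hg b)
  exact h1.trans (e.apply_symm_apply (f b))

/-- The average of the homomorphisms `f ∘ τ ^ i` is a homomorphism if they agree modulo an ideal
of square zero, since their differences are derivations. -/
theorem AlgHom.exists_average {A B E E' : Type*} [CommRing A] [CommRing B] [CommRing E]
    [CommRing E'] [Algebra A B] [Algebra A E] [Algebra A E'] (q : E →ₐ[A] E')
    (hker : RingHom.ker q ^ 2 = ⊥) (f : B →ₐ[A] E) (τ : B →ₐ[A] B) {n : ℕ}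
    (hτ : ∀ x, τ^[n] x = x) (hn : IsUnit (n : E)) (hf : ∀ x, q (f (τ x)) = q (f x)) :
    ∃ h : B →ₐ[A] E, (∀ x, h (τ x) = h x) ∧ (∀ x, q (h x) = q (f x)) ∧
      ∀ x, (∀ i, f (τ^[i] x) = 0) → h x = 0 := by
  obtain ⟨ν, hν⟩ := hn.exists_left_inv
  have hmem : ∀ i x, f (τ^[i] x) - f x ∈ RingHom.ker q := by
    intro i x
    rw [RingHom.mem_ker, map_sub, sub_eq_zero]
    induction i with
    | zero => rfl
    | succ i ih => rw [Function.iterate_succ_apply', hf, ih]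
  have hmul : ∀ a ∈ RingHom.ker q, ∀ b ∈ RingHom.ker q, a * b = 0 := by
    intro a ha b hb
    have h1 : a * b ∈ RingHom.ker q ^ 2 := by
      rw [pow_two]
      exact Ideal.mul_mem_mul ha hb
    rwa [hker, Ideal.mem_bot] at h1
  have hτm : ∀ (i : ℕ), (τ^[i] : B → B) = ⇑(τ ^ i) := fun i => (AlgHom.coe_pow τ i).symm
  let s : B →ₗ[A] E := ν • ∑ i ∈ Finset.range n, (f.comp (τ ^ i)).toLinearMap
  have hs : ∀ x, s x = ν * ∑ i ∈ Finset.range n, f (τ^[i] x) := fun x => by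
    simp only [s, hτm, LinearMap.smul_apply, LinearMap.sum_apply, smul_eq_mul,
      AlgHom.toLinearMap_apply, AlgHom.comp_apply]
  have hd : ∀ x, s x = f x + ν * ∑ i ∈ Finset.range n, (f (τ^[i] x) - f x) := fun x => by
    rw [hs, Finset.sum_sub_distrib, Finset.sum_const, Finset.card_range, nsmul_eq_mul, mul_sub,
      ← mul_assoc ν, hν]
    ring
  have hdk : ∀ x, ν * ∑ i ∈ Finset.range n, (f (τ^[i] x) - f x) ∈ RingHom.ker q := fun x =>
    Ideal.mul_mem_left _ _ (Ideal.sum_mem _ fun i _ => hmem i x)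
  refine ⟨AlgHom.ofLinearMap s ?_ ?_, ?_, ?_, ?_⟩
  · rw [hs]
    simp only [hτm, map_one, Finset.sum_const, Finset.card_range, nsmul_eq_mul, mul_one, hν]
  · intro x y
    have h1 : ∑ i ∈ Finset.range n, (f (τ^[i] (x * y)) - f (x * y)) =
        f x * ∑ i ∈ Finset.range n, (f (τ^[i] y) - f y) +
          f y * ∑ i ∈ Finset.range n, (f (τ^[i] x) - f x) := by
      rw [Finset.mul_sum, Finset.mul_sum, ← Finset.sum_add_distrib]
      refine Finset.sum_congr rfl fun i _ => ?_
      have h2 := hmul _ (hmem i x) _ (hmem i y)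
      rw [hτm] at h2 ⊢
      rw [map_mul, map_mul, map_mul]
      linear_combination h2
    have h3 := hmul _ (hdk x) _ (hdk y)
    rw [hd (x * y), hd x, hd y, h1, map_mul]
    linear_combination -h3
  · intro x
    rw [AlgHom.ofLinearMap_apply, AlgHom.ofLinearMap_apply, hs, hs]
    congr 1
    have h1 : ∑ i ∈ Finset.range n, f (τ^[i] (τ x)) =
        ∑ i ∈ Finset.range n, f (τ^[i + 1] x) := rfl
    have h2 := Finset.sum_range_succ (fun i => f (τ^[i] x)) n
    rw [Finset.sum_range_succ', hτ] at h2
    rw [h1]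
    exact add_right_cancel h2
  · intro x
    rw [AlgHom.ofLinearMap_apply, hd, map_add, (RingHom.mem_ker).mp (hdk x), add_zero]
  · intro x hx
    rw [AlgHom.ofLinearMap_apply, hs, Finset.sum_eq_zero fun i _ => hx i, mul_zero]

/-- A formally smooth local algebra with an automorphism `τ` of invertible order which acts
trivially on the residue field has `τ`-invariant homomorphisms to all its truncations: formal
smoothness lifts them from one truncation to the next and averaging makes the lift invariant. -/
theorem IsAdicallyFormallySmooth.exists_invariant_hom {V : Type u} [CommRing V] {O : Type v}
    [CommRing O] [IsLocalRing O] [Algebra V O]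
    (hO : IsAdicallyFormallySmooth V O (maximalIdeal O)) (τ : O →ₐ[V] O) {n : ℕ}
    (hτ : ∀ x, τ^[n] x = x) (hn : IsUnit (n : O)) (hm : ∀ x, τ x - x ∈ maximalIdeal O) (j : ℕ) :
    ∃ h : O →ₐ[V] O ⧸ maximalIdeal O ^ (j + 1), (∀ x, h (τ x) = h x) ∧
      ∃ m : ℕ, ∀ x ∈ maximalIdeal O ^ m, h x = 0 := by
  induction j with
  | zero =>
    refine ⟨Ideal.Quotient.mkₐ V _, fun x => ?_, 1, fun x hx => ?_⟩
    · rw [Ideal.Quotient.mkₐ_eq_mk, Ideal.Quotient.mk_eq_mk_iff_sub_mem, zero_add, pow_one]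
      exact hm x
    · exact Ideal.Quotient.eq_zero_iff_mem.mpr hx
  | succ j ih =>
    obtain ⟨h, hinv, hcont⟩ := ih
    let q : O ⧸ maximalIdeal O ^ (j + 1 + 1) →ₐ[V] O ⧸ maximalIdeal O ^ (j + 1) :=
      Ideal.Quotient.factorₐ V (Ideal.pow_le_pow_right (Nat.le_succ _))
    have hq : Function.Surjective q :=
      Ideal.Quotient.factor_surjective (Ideal.pow_le_pow_right (Nat.le_succ _))
    have hker : RingHom.ker q ^ 2 = ⊥ := by
      have h1 : RingHom.ker q =
          (maximalIdeal O ^ (j + 1)).map (Ideal.Quotient.mk (maximalIdeal O ^ (j + 1 + 1))) :=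
        Ideal.Quotient.factor_ker (Ideal.pow_le_pow_right (Nat.le_succ _))
      rw [h1, ← Ideal.map_pow, ← pow_mul, eq_bot_iff,
        ← Ideal.map_quotient_self (maximalIdeal O ^ (j + 1 + 1))]
      exact Ideal.map_mono (Ideal.pow_le_pow_right (by omega))
    obtain ⟨f, ⟨m, hfm⟩, hqf⟩ := hO.exists_lift q hq hker h hcont
    have hqf' : ∀ x, q (f x) = h x := fun x => DFunLike.congr_fun hqf x
    obtain ⟨h', h1, -, h3⟩ := AlgHom.exists_average q hker f τ hτ
      (by simpa using hn.map (Ideal.Quotient.mk (maximalIdeal O ^ (j + 1 + 1))))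
      (fun x => by rw [hqf', hqf', hinv])
    refine ⟨h', h1, m, fun x hx => h3 x fun i => hfm _ ?_⟩
    induction i with
    | zero => exact hx
    | succ i ihi =>
      rw [Function.iterate_succ_apply']
      have hle : maximalIdeal O ≤ (maximalIdeal O).comap τ := fun y hy => by
        rw [Ideal.mem_comap, ← sub_add_cancel (τ y) y]
        exact Ideal.add_mem _ (hm y) hy
      exact ((Ideal.pow_right_mono hle m).trans (Ideal.le_comap_pow _ _)) ihi

variable {V : Type u} [CommRing V] [IsDomain V] [IsDiscreteValuationRing V]
  {R : Type v} [CommRing R] [Algebra V R] [IsRegularRing R]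
  {C : Type*} [Group C] [MulSemiringAction C R] [SMulCommClass C V R]

/-- A prime of residue characteristic `p` in the fixed locus of an automorphism of order prime to
`p` generizes to a point of the fixed locus of characteristic different from `p`: a power of `p`
in the ideal of the fixed locus would be killed by the invariant homomorphisms to all truncations
of the local ring. -/
theorem IsPointwiseFormallySmooth.exists_prime_forall_smul_sub_mem
    (hR : IsPointwiseFormallySmooth V R) {ϖ w : V} (hϖ : Irreducible ϖ) (hw : IsUnit w) {p e : ℕ}
    (hp : (p : V) = w * ϖ ^ e) (𝔭 : Ideal R) [𝔭.IsPrime] (h𝔭 : algebraMap V R ϖ ∈ 𝔭)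
    {g : C} (hg : ∀ x : R, g • x - x ∈ 𝔭) (hord : ((orderOf g : ℕ) : R) ∉ 𝔭) :
    ∃ 𝔮 : Ideal R, 𝔮.IsPrime ∧ (p : R) ∉ 𝔮 ∧ ∀ x : R, g • x - x ∈ 𝔮 := by
  set O := Localization.AtPrime 𝔭
  have := IsRegularLocalRing.isDomain O
  let gR : R →+* R := MulSemiringAction.toRingHom C R g
  have hgR : ∀ x, gR x - x ∈ 𝔭 := hg
  let τ : O →ₐ[V] O :=
    { inertialMap 𝔭 gR hgR with
      commutes' := fun r => by
        change inertialMap 𝔭 gR hgR (algebraMap V O r) = _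
        rw [IsScalarTower.algebraMap_apply V R O, inertialMap_algebraMap]
        congr 1
        change g • (algebraMap V R r) = _
        rw [Algebra.algebraMap_eq_smul_one, smul_comm, smul_one] }
  have hτ : ∀ x, τ^[orderOf g] x = x := inertialMap_iterate_eq_self hgR fun x => by
    have : ∀ k, gR^[k] x = g ^ k • x := fun k => by
      induction k with
      | zero => simp
      | succ k ih => rw [Function.iterate_succ_apply', ih, pow_succ', mul_smul]; rfl
    rw [this, pow_orderOf_eq_one, one_smul]
  have hn : IsUnit ((orderOf g : ℕ) : O) := by
    rw [← map_natCast (algebraMap R O)]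
    exact (IsLocalization.AtPrime.isUnit_to_map_iff O 𝔭 _).mpr hord
  have hinv := (hR 𝔭).exists_invariant_hom τ hτ hn (inertialMap_sub_mem_maximalIdeal hgR)
  let J : Ideal R := Ideal.span (Set.range fun x : R => g • x - x)
  have hdisj : Disjoint (J : Set R) (Submonoid.powers (p : R) : Set R) := by
    rw [Set.disjoint_right]
    rintro _ ⟨k, rfl⟩ hk
    have h0 : algebraMap R O ((p : R) ^ k) = 0 := by
      rw [← Ideal.mem_bot, ← Ideal.iInf_pow_eq_bot_of_isLocalRing (maximalIdeal O)
        (maximalIdeal.isMaximal O).ne_top, Ideal.mem_iInf]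
      intro j
      obtain ⟨h, h1, -⟩ := hinv j
      refine Ideal.pow_le_pow_right (Nat.le_succ j) (Ideal.Quotient.eq_zero_iff_mem.mp ?_)
      have hle : J ≤ RingHom.ker (h.toRingHom.comp (algebraMap R O)) := by
        rw [Ideal.span_le]
        rintro _ ⟨x, rfl⟩
        have h2 := h1 (algebraMap R O x)
        have h3 : τ (algebraMap R O x) = algebraMap R O (g • x) :=
          inertialMap_algebraMap hgR x
        rw [h3] at h2
        rw [SetLike.mem_coe, RingHom.mem_ker, map_sub]
        exact sub_eq_zero.mpr h2
      have h4 : h (algebraMap R O ((p : R) ^ k)) = 0 := hle hk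
      simpa using h4
    have h5 : algebraMap V O ϖ ≠ 0 := hR.algebraMap_localization_ne_zero hϖ 𝔭 h𝔭
    have h6 : algebraMap R O (p : R) = algebraMap V O w * algebraMap V O ϖ ^ e := by
      rw [map_natCast, ← map_natCast (algebraMap V O), hp, map_mul, map_pow]
    rw [map_pow, h6] at h0
    exact pow_ne_zero _ (mul_ne_zero (hw.map _).ne_zero (pow_ne_zero _ h5)) h0
  obtain ⟨𝔮, h𝔮, hle, hdisj'⟩ := Ideal.exists_le_prime_disjoint J _ hdisj
  refine ⟨𝔮, h𝔮, fun hmem => ?_, fun x => hle (Ideal.subset_span ⟨x, rfl⟩)⟩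
  exact Set.disjoint_left.mp hdisj' hmem (Submonoid.mem_powers _)

end Tame

/-! ### Kummer generators of cyclic extensions of factorial rings -/

section Kummer

variable {S : Type*} [CommRing S]

/-- The Lagrange resolvent `∑ i < p, η ^ i * g ^ i b` of an endomorphism `g` of order `p`. -/
def lagrangeResolvent (g : S →+* S) (p : ℕ) (η b : S) : S :=
  ∑ i ∈ Finset.range p, η ^ i * g^[i] b

variable {g : S →+* S} {p : ℕ}

theorem mul_map_lagrangeResolvent (hg : ∀ s, g^[p] s = s) {η : S} (hη : g η = η)
    (hηp : η ^ p = 1) (b : S) :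
    η * g (lagrangeResolvent g p η b) = lagrangeResolvent g p η b := by
  have h1 : η * g (lagrangeResolvent g p η b) =
      ∑ i ∈ Finset.range p, η ^ (i + 1) * g^[i + 1] b := by
    rw [lagrangeResolvent, map_sum, Finset.mul_sum]
    refine Finset.sum_congr rfl fun i _ => ?_
    rw [map_mul, map_pow, hη, Function.iterate_succ_apply', pow_succ']
    ring
  have h2 := Finset.sum_range_succ (fun i => η ^ i * g^[i] b) p
  rw [Finset.sum_range_succ', hg, hηp, pow_zero, Function.iterate_zero_apply] at h2
  rw [h1]
  exact add_right_cancel h2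

theorem map_lagrangeResolvent (hg : ∀ s, g^[p] s = s) {ζ η : S} (hζη : ζ * η = 1) (hη : g η = η)
    (hηp : η ^ p = 1) (b : S) :
    g (lagrangeResolvent g p η b) = ζ * lagrangeResolvent g p η b := by
  rw [← mul_map_lagrangeResolvent hg hη hηp b, ← mul_assoc, hζη, one_mul,
    mul_map_lagrangeResolvent hg hη hηp]

theorem lagrangeResolvent_mul_of_map_eq {ζ η y c : S} (hζη : ζ * η = 1) (hζ : g ζ = ζ)
    (hy : g y = ζ * y) (hc : g c = c) : lagrangeResolvent g p η (c * y) = p * (c * y) := by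
  have h : ∀ i, g^[i] (c * y) = ζ ^ i * (c * y) := by
    intro i
    induction i with
    | zero => simp
    | succ i ih =>
      rw [Function.iterate_succ_apply', ih, map_mul, map_pow, hζ, map_mul, hc, hy]
      ring
  rw [lagrangeResolvent, Finset.sum_congr rfl fun i _ => by
    rw [h, ← mul_assoc, ← mul_pow, mul_comm η, hζη, one_pow, one_mul]]
  simp

theorem iterate_map_mul_of_map_eq {c s : S} (hc : g c = c) (i : ℕ) :
    g^[i] (c * s) = c * g^[i] s := by
  induction i with
  | zero => rfl
  | succ i ih => rw [Function.iterate_succ_apply', ih, map_mul, hc, Function.iterate_succ_apply']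

theorem lagrangeResolvent_mul {η c : S} (hc : g c = c) (s : S) :
    lagrangeResolvent g p η (c * s) = c * lagrangeResolvent g p η s := by
  rw [lagrangeResolvent, lagrangeResolvent, Finset.mul_sum]
  refine Finset.sum_congr rfl fun i _ => ?_
  rw [iterate_map_mul_of_map_eq hc]
  ring

theorem pow_dvd_of_pow_dvd_pow {ϖ : S} (hϖ : ∀ a, ϖ * a = 0 → a = 0)
    (hrad : (Ideal.span {ϖ}).IsRadical) (hp : p ≠ 0) (M : ℕ) {x : S}
    (h : (ϖ ^ M) ^ p ∣ x ^ p) : ϖ ^ M ∣ x := by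
  have hpow : ∀ n a, ϖ ^ n * a = 0 → a = 0 := by
    intro n
    induction n with
    | zero => simp
    | succ n ih => exact fun a ha => ih a (hϖ _ (by rw [← ha]; ring))
  induction M generalizing x with
  | zero => simp
  | succ M ih =>
    have h1 : ϖ ∣ x := by
      refine Ideal.mem_span_singleton.mp (hrad ⟨p, Ideal.mem_span_singleton.mpr ?_⟩)
      exact ((dvd_pow_self ϖ M.succ_ne_zero).trans (dvd_pow_self _ hp)).trans h
    obtain ⟨x, rfl⟩ := h1
    obtain ⟨c, hc⟩ := h
    obtain ⟨d, rfl⟩ := ih (x := x) ⟨c, sub_eq_zero.mp (hpow p _ (by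
      rw [mul_sub, ← mul_pow, hc]; ring))⟩
    exact ⟨d, by ring⟩

/-- Let `T` be the ring of invariants of `g`, and let `y` be an eigenvector for `ζ` whose `p`-th
power is divisible by a prime `q` of `T`. Then `y / q` is again integral. If `q` divides `ϖ`
this holds because `S / ϖ` is reduced. Otherwise the products of `y` with resolvents for `ζ⁻¹` are
invariants divisible by `q`, so `q` divides `ϖ ^ N * y`, and the power of `ϖ` can be
removed because `S / ϖ` is reduced. -/
theorem exists_eq_mul_eigenvector {T : Subring S} (hT : ∀ s, s ∈ T ↔ g s = s) [IsDomain T]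
    (hg : ∀ s, g^[p] s = s) (hp : p ≠ 0) {ζ η ϖ w v : S} (hζη : ζ * η = 1)
    (hζ : g ζ = ζ) (hζp : ζ ^ p = 1) (hϖT : g ϖ = ϖ) (hϖ : ∀ a, ϖ * a = 0 → a = 0)
    (hrad : (Ideal.span {ϖ}).IsRadical) {k N : ℕ} (hpk : (p : S) = w * ϖ ^ k) (hwv : w * v = 1)
    (hN : ϖ ^ N ∈ Ideal.span (Set.range (lagrangeResolvent g p ζ)))
    {q u : T} (hq : Prime q) (hqu : q ∣ u) {y : S} (hy : g y = ζ * y) (hyu : y ^ p = u) :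
    ∃ s, y = q * s ∧ g s = ζ * s := by
  have hpow : ∀ n a, ϖ ^ n * a = 0 → a = 0 := by
    intro n
    induction n with
    | zero => simp
    | succ n ih => exact fun a ha => ih a (hϖ _ (by rw [← ha]; ring))
  have hgq : g q = q := (hT _).mp q.2
  have hηT : g η = η := by
    have h1 : ζ * g η = 1 := by rw [← map_one g, ← hζη, map_mul, hζ]
    calc g η = (ζ * η) * g η := by rw [hζη, one_mul]
      _ = η * (ζ * g η) := by ring
      _ = η := by rw [h1, mul_one]
  have hηp : η ^ p = 1 := by
    have h1 : ζ ^ p * η ^ p = 1 := by rw [← mul_pow, hζη, one_pow]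
    rwa [hζp, one_mul] at h1
  let ϖT : T := ⟨ϖ, (hT _).mpr hϖT⟩
  by_cases hqϖ : q ∣ ϖT
  · obtain ⟨c, hc⟩ := hqϖ
    have hc' : ϖ = q * c := congrArg Subtype.val hc
    obtain ⟨u', rfl⟩ := hqu
    have h1 : c * y ∈ Ideal.span {ϖ} := by
      refine hrad ⟨p, Ideal.mem_span_singleton.mpr ?_⟩
      obtain ⟨n, rfl⟩ := Nat.exists_eq_add_one_of_ne_zero hp
      refine ⟨(c : S) ^ n * u', ?_⟩
      rw [mul_pow, hyu, hc', Subring.coe_mul]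
      ring
    obtain ⟨s, hs⟩ := Ideal.mem_span_singleton.mp h1
    have h2 : y = q * s := by
      refine sub_eq_zero.mp (hϖ _ ?_)
      rw [hc']
      linear_combination (q : S) * hs + (q : S) * s * hc'
    refine ⟨s, h2, sub_eq_zero.mp (hϖ _ ?_)⟩
    rw [h2, map_mul, hgq] at hy
    rw [hc']
    linear_combination (c : S) * hy
  · obtain ⟨s, hs⟩ : (q : S) ∣ ϖ ^ N * y := by
      have hle : Ideal.span (Set.range (lagrangeResolvent g p ζ)) ≤
          (Ideal.span {(q : S)}).colon {y} := by
        rw [Ideal.span_le]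
        rintro _ ⟨b, rfl⟩
        set z := lagrangeResolvent g p ζ b with hz
        have hgz : g z = η * z :=
          map_lagrangeResolvent hg (by rw [mul_comm, hζη]) hζ hζp b
        have hyz : z * y ∈ T := by
          rw [hT, map_mul, hgz, hy]
          linear_combination z * y * hζη
        have hzp : z ^ p ∈ T := by rw [hT, map_pow, hgz, mul_pow, hηp, one_mul]
        have h1 : q ∣ (⟨z * y, hyz⟩ : T) ^ p := by
          have h2 : (⟨z * y, hyz⟩ : T) ^ p = ⟨z ^ p, hzp⟩ * u := by
            ext
            rw [Subring.coe_pow, Subring.coe_mul, ← hyu, mul_pow]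
          rw [h2]
          exact hqu.mul_left _
        obtain ⟨t, ht⟩ := hq.dvd_of_dvd_pow h1
        rw [SetLike.mem_coe, Submodule.mem_colon_singleton]
        exact Ideal.mem_span_singleton.mpr ⟨t, congrArg Subtype.val ht⟩
      exact Ideal.mem_span_singleton.mp (Submodule.mem_colon_singleton.mp (hle hN))
    set s' := lagrangeResolvent g p η s with hs'
    have hgs' : g s' = ζ * s' := map_lagrangeResolvent hg hζη hηT hηp s
    have hgv : g v = v := by
      have h1 : g w = w := by
        refine sub_eq_zero.mp (hpow k _ ?_)
        have h2 := congrArg g hpk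
        rw [map_natCast, map_mul, map_pow, hϖT, hpk] at h2
        linear_combination -h2
      have h1 : w * g v = 1 := by rw [← map_one g, ← hwv, map_mul, h1]
      calc g v = (w * v) * g v := by rw [hwv, one_mul]
        _ = v * (w * g v) := by ring
        _ = v := by rw [h1, mul_one]
    -- The element `v * s'` is the eigencomponent of `s`, up to a power of `ϖ`.
    have h1 : (q : S) * (v * s') = ϖ ^ (N + k) * y := by
      have h2 : (q : S) * s' = p * (ϖ ^ N * y) := by
        rw [hs', ← lagrangeResolvent_mul hgq, ← hs]
        exact lagrangeResolvent_mul_of_map_eq hζη hζ hy (by rw [map_pow, hϖT])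
      rw [hpk] at h2
      linear_combination v * h2 + ϖ ^ (N + k) * y * hwv
    have hgvs : g (v * s') = ζ * (v * s') := by
      rw [map_mul, hgv, hgs']
      ring
    have hvsT : (v * s') ^ p ∈ T := by
      rw [hT, map_pow, hgvs, mul_pow, hζp, one_mul]
    have h3 : q ^ p * ⟨(v * s') ^ p, hvsT⟩ = (ϖT ^ (N + k)) ^ p * u := by
      ext
      rw [Subring.coe_mul, Subring.coe_pow, Subring.coe_mul, Subring.coe_pow, Subring.coe_pow,
        ← hyu, ← mul_pow, ← mul_pow, ← h1]
    have h4 : q ^ p ∣ u := by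
      refine hq.pow_dvd_of_dvd_mul_left p (fun h => hqϖ ?_) (h3 ▸ dvd_mul_right _ _)
      exact hq.dvd_of_dvd_pow (hq.dvd_of_dvd_pow h)
    obtain ⟨u', rfl⟩ := h4
    have h5 : (⟨(v * s') ^ p, hvsT⟩ : T) = (ϖT ^ (N + k)) ^ p * u' := by
      refine mul_left_cancel₀ (pow_ne_zero p hq.ne_zero) ?_
      rw [h3]
      ring
    obtain ⟨s'', hs''⟩ := pow_dvd_of_pow_dvd_pow hϖ hrad hp (N + k) (x := v * s')
      ⟨u', congrArg Subtype.val h5⟩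
    refine ⟨s'', sub_eq_zero.mp (hpow (N + k) _ ?_), sub_eq_zero.mp (hpow (N + k) _ ?_)⟩
    · rw [mul_sub, ← h1, hs'']
      ring
    · rw [hs'', map_mul, map_pow, hϖT] at hgvs
      linear_combination hgvs

/-- If the ring of invariants `T` of `g` is factorial, `S / ϖ` is reduced and the Lagrange
resolvents generate the unit ideal away from `ϖ`, then `S` contains a unit `y` with `g y = ζ y`:
divide a resolvent with nonzero `p`-th power by primes of `T` as long as possible. -/
theorem exists_isUnit_eigenvector [Nontrivial S] {T : Subring S} (hT : ∀ s, s ∈ T ↔ g s = s)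
    [IsDomain T] [UniqueFactorizationMonoid T]
    (hg : ∀ s, g^[p] s = s) (hp : p ≠ 0) {ζ η ϖ w v : S} (hζη : ζ * η = 1)
    (hζ : g ζ = ζ) (hζp : ζ ^ p = 1) (hϖT : g ϖ = ϖ) (hϖ : ∀ a, ϖ * a = 0 → a = 0)
    (hrad : (Ideal.span {ϖ}).IsRadical) {k N : ℕ} (hpk : (p : S) = w * ϖ ^ k) (hwv : w * v = 1)
    (hN : ϖ ^ N ∈ Ideal.span (Set.range (lagrangeResolvent g p ζ)))
    (hN' : ϖ ^ N ∈ Ideal.span (Set.range (lagrangeResolvent g p η))) :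
    ∃ y, IsUnit y ∧ g y = ζ * y := by
  have hdiv : ∀ u : T, u ≠ 0 → ∀ y, g y = ζ * y → y ^ p = u → ∃ y, IsUnit y ∧ g y = ζ * y := by
    intro u
    induction u using (wellFounded_dvdNotUnit (α := T)).induction with
    | _ u ih =>
      intro hu y hy hyu
      by_cases hunit : IsUnit u
      · refine ⟨y, (isUnit_pow_iff hp).mp ?_, hy⟩
        rw [hyu]
        exact hunit.map T.subtype
      · obtain ⟨q, hqi, hqu⟩ := WfDvdMonoid.exists_irreducible_factor hunit hu
        have hq := UniqueFactorizationMonoid.irreducible_iff_prime.mp hqi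
        obtain ⟨s, rfl, hs⟩ := exists_eq_mul_eigenvector hT hg hp hζη hζ hζp hϖT hϖ hrad hpk hwv hN
          hq hqu hy hyu
        have hsT : s ^ p ∈ T := by rw [hT, map_pow, hs, mul_pow, hζp, one_mul]
        have hu' : u = ⟨s ^ p, hsT⟩ * q ^ p := by
          ext
          rw [Subring.coe_mul, Subring.coe_pow, ← hyu]
          ring
        have hne : (⟨s ^ p, hsT⟩ : T) ≠ 0 := left_ne_zero_of_mul (hu' ▸ hu)
        exact ih ⟨s ^ p, hsT⟩ ⟨hne, q ^ p, fun h => hq.not_isUnit ((isUnit_pow_iff hp).mp h), hu'⟩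
          hne s hs rfl
  have hηT : g η = η := by
    have h1 : ζ * g η = 1 := by rw [← map_one g, ← hζη, map_mul, hζ]
    calc g η = (ζ * η) * g η := by rw [hζη, one_mul]
      _ = η * (ζ * g η) := by ring
      _ = η := by rw [h1, mul_one]
  have hηp : η ^ p = 1 := by
    have h1 : ζ ^ p * η ^ p = 1 := by rw [← mul_pow, hζη, one_pow]
    rwa [hζp, one_mul] at h1
  have heig := map_lagrangeResolvent hg hζη hηT hηp
  obtain ⟨b, hb⟩ : ∃ b, lagrangeResolvent g p η b ^ p ≠ 0 := by
    by_contra! h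
    have hle : Ideal.span (Set.range (lagrangeResolvent g p η)) ≤ nilradical S := by
      rw [Ideal.span_le]
      rintro _ ⟨b, rfl⟩
      exact ⟨p, h b⟩
    obtain ⟨n, hn⟩ := hle hN'
    have hpow : ∀ n, ϖ ^ n ≠ 0 := by
      intro n
      induction n with
      | zero => simp
      | succ n ih =>
        rw [pow_succ']
        exact fun h => ih (hϖ _ h)
    rw [← pow_mul] at hn
    exact hpow _ hn
  have hbT : lagrangeResolvent g p η b ^ p ∈ T := by
    rw [hT, map_pow, heig, mul_pow, hζp, one_mul]
  exact hdiv ⟨_, hbT⟩ (fun h => hb (congrArg Subtype.val h)) _ (heig b) rfl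

end Kummer

/-! ### Descent along tame ramification -/

section TameDescent

open IsLocalRing

theorem exists_one_add_pow_eq {S : Type*} [CommRing S] (x : S) (a : ℕ) :
    ∃ t, (1 + x) ^ a = 1 + a * x + x ^ 2 * t := by
  induction a with
  | zero => exact ⟨0, by simp⟩
  | succ a ih =>
    obtain ⟨t, ht⟩ := ih
    exact ⟨a + t + x * t, by rw [pow_succ, ht]; push_cast; ring⟩

variable {S : Type*} [CommRing S] {g σ : S →+* S}

theorem map_eq_self_of_mul_eq_one {x y : S} (h : x * y = 1) (hx : g x = x) : g y = y := by
  have h1 : x * g y = 1 := by rw [← map_one g, ← h, map_mul, hx]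
  calc g y = (x * y) * g y := by rw [h, one_mul]
    _ = y * (x * g y) := by ring
    _ = y := by rw [h1, mul_one]

theorem map_mul_inv_pow_of_eigenvector {ζ : S} (hσg : ∀ s, σ (g s) = g (σ s))
    {a : ℕ} (hσζ : σ ζ = ζ ^ a) (y : Sˣ) (hy : g y = ζ * y) :
    g (σ y * (↑y⁻¹ : S) ^ a) = σ y * (↑y⁻¹ : S) ^ a := by
  have h1 : (y : S) ^ a * (↑y⁻¹ : S) ^ a = 1 := by rw [← mul_pow, y.mul_inv, one_pow]
  have h2 : ζ ^ a * (y : S) ^ a * g ((↑y⁻¹ : S) ^ a) = 1 := by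
    rw [← mul_pow, ← hy, ← map_pow, ← map_mul, h1, map_one]
  rw [map_mul, ← hσg, hy, map_mul, hσζ]
  linear_combination σ ↑y * (↑y⁻¹ : S) ^ a * h2 - ζ ^ a * σ ↑y * g ((↑y⁻¹ : S) ^ a) * h1

/-- One step in the approximation of an eigenvector `y` by invariants modulo powers of `ϖ`: if
`y = 1 + ϖ ^ j z`, comparing `σ y` with the invariant multiple `b y ^ a` shows that `θ ^ j - a`
times `z` is invariant modulo `ϖ`. -/
theorem exists_invariant_dvd_sub_of_one_add {ζ ϖ θ : S} (hσg : ∀ s, σ (g s) = g (σ s))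
    {a : ℕ} (hσζ : σ ζ = ζ ^ a) (hϖT : g ϖ = ϖ) (hϖ : ∀ s, ϖ * s = 0 → s = 0)
    (hσϖ : σ ϖ = θ * ϖ) (hθ : g θ = θ) (hσ : ∀ s, ϖ ∣ σ s - s) {j : ℕ} (hj : j ≠ 0)
    (hunit : IsUnit (θ ^ j - a)) (y : Sˣ) (hy : g y = ζ * y) (h1 : ϖ ^ j ∣ y - 1) :
    ∃ c, g c = c ∧ ϖ ^ (j + 1) ∣ y - c := by
  have hpow : ∀ n s, ϖ ^ n * s = 0 → s = 0 := by
    intro n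
    induction n with
    | zero => simp
    | succ n ih => exact fun s hs => ih s (hϖ _ (by rw [← hs]; ring))
  obtain ⟨z, hz⟩ := h1
  have hyz : (y : S) = 1 + ϖ ^ j * z := by linear_combination hz
  obtain ⟨i, rfl⟩ := Nat.exists_eq_add_one_of_ne_zero hj
  set b := σ y * (↑y⁻¹ : S) ^ a with hb
  have hgb : g b = b := map_mul_inv_pow_of_eigenvector hσg hσζ y hy
  have hby : b * (y : S) ^ a = σ y := by
    rw [hb, mul_assoc, ← mul_pow, y.inv_mul, one_pow, mul_one]
  obtain ⟨t, ht⟩ := exists_one_add_pow_eq (ϖ ^ (i + 1) * z) a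
  obtain ⟨t', ht'⟩ := hσ z
  have hσz : σ z = z + ϖ * t' := by linear_combination ht'
  have hσy : σ y = 1 + ϖ ^ (i + 1) * (θ ^ (i + 1) * (z + ϖ * t')) := by
    rw [hyz, map_add, map_one, map_mul, map_pow, hσϖ, hσz]
    ring
  rw [hyz, ht, ← hyz, hσy] at hby
  -- `b` is congruent to `1` modulo the same power of `ϖ` as `y`.
  obtain ⟨b', hb'⟩ : ϖ ^ (i + 1) ∣ b - 1 := by
    refine ⟨θ ^ (i + 1) * (z + ϖ * t') - b * (a * z + ϖ ^ (i + 1) * z ^ 2 * t), ?_⟩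
    linear_combination hby
  have hbb : b = 1 + ϖ ^ (i + 1) * b' := by linear_combination hb'
  have hgb' : g b' = b' := by
    refine sub_eq_zero.mp (hpow (i + 1) _ ?_)
    rw [hbb, map_add, map_one, map_mul, map_pow, hϖT] at hgb
    linear_combination hgb
  have key : (θ ^ (i + 1) - a) * z + ϖ * (θ ^ (i + 1) * t' - ϖ ^ i * z ^ 2 * t
      - ϖ ^ i * b' * (a * z + ϖ ^ (i + 1) * z ^ 2 * t)) = b' := by
    refine sub_eq_zero.mp (hpow (i + 1) _ ?_)
    rw [hbb] at hby
    linear_combination -hby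
  obtain ⟨κ, hκ⟩ := hunit.exists_right_inv
  have hgκ : g κ = κ := map_eq_self_of_mul_eq_one hκ (by rw [map_sub, map_pow, hθ, map_natCast])
  refine ⟨1 + ϖ ^ (i + 1) * (b' * κ), by simp only [map_add, map_one, map_mul, map_pow, hϖT, hgb',
    hgκ], ?_⟩
  refine ⟨-κ * (θ ^ (i + 1) * t' - ϖ ^ i * z ^ 2 * t
      - ϖ ^ i * b' * (a * z + ϖ ^ (i + 1) * z ^ 2 * t)), ?_⟩
  rw [hyz]
  linear_combination ϖ ^ (i + 1) * κ * key - ϖ ^ (i + 1) * z * hκ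

/-- A unit `y` with `g y = ζ y` is congruent to an invariant modulo `ζ - 1`, so that
`z = (y - c) / ϖ ^ m` satisfies `g z - z = w y`. -/
theorem exists_isUnit_map_sub [IsLocalRing S] {ζ ϖ θ w : S} (hσg : ∀ s, σ (g s) = g (σ s))
    {a r l p m : ℕ} (hσζ : σ ζ = ζ ^ (a + 1)) (har : a * r = p * l + 1) (hζp : ζ ^ p = 1)
    (hϖT : g ϖ = ϖ) (hϖ : ∀ s, ϖ * s = 0 → s = 0) (hϖm : ϖ ∈ maximalIdeal S)
    (hσϖ : σ ϖ = θ * ϖ) (hθ : g θ = θ) (hσ : ∀ s, ϖ ∣ σ s - s)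
    (hunit : ∀ j, j ≠ 0 → j < m → IsUnit (θ ^ j - (a + 1 : ℕ)))
    (hζ1 : ζ - 1 = w * ϖ ^ m) (hw : IsUnit w) (y : Sˣ) (hy : g y = ζ * y) :
    ∃ z, IsUnit (g z - z) := by
  have hpow : ∀ n s, ϖ ^ n * s = 0 → s = 0 := by
    intro n
    induction n with
    | zero => simp
    | succ n ih => exact fun s hs => ih s (hϖ _ (by rw [← hs]; ring))
  have hcunit : ∀ c, ϖ ∣ y - c → IsUnit c := by
    rintro c ⟨t, ht⟩
    by_contra hc
    have h1 : (y : S) ∈ maximalIdeal S := by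
      rw [← sub_add_cancel (y : S) c, ht]
      exact Ideal.add_mem _ (Ideal.mul_mem_right _ _ hϖm) hc
    exact h1 y.isUnit
  have key : ∀ j ≤ m, ∃ c, g c = c ∧ ϖ ^ j ∣ y - c := by
    intro j
    induction j with
    | zero => exact fun _ => ⟨1, map_one g, by simp⟩
    | succ j ih =>
      intro hjm
      rcases Nat.eq_zero_or_pos j with rfl | hj
      · -- Modulo `ϖ` both `y ^ a` and `y ^ p` are invariant, and `a` is prime to `p`.
        set b := σ y * (↑y⁻¹ : S) ^ (a + 1) with hb
        have hgb : g b = b := map_mul_inv_pow_of_eigenvector hσg hσζ y hy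
        have hgu : g ((y : S) ^ p) = (y : S) ^ p := by rw [map_pow, hy, mul_pow, hζp, one_mul]
        have h1 : ϖ ∣ b * (y : S) ^ a - 1 := by
          obtain ⟨t, ht⟩ := hσ y
          refine ⟨t * ↑y⁻¹, ?_⟩
          have h2 : (y : S) ^ a * (↑y⁻¹ : S) ^ a = 1 := by rw [← mul_pow, y.mul_inv, one_pow]
          rw [hb, pow_succ]
          linear_combination (↑y⁻¹ : S) * ht + σ y * (↑y⁻¹ : S) * h2 + y.mul_inv
        have h3 : ϖ ∣ (b ^ r * ((y : S) ^ p) ^ l) * y - 1 := by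
          have h4 : (b ^ r * ((y : S) ^ p) ^ l) * y = (b * (y : S) ^ a) ^ r := by
            rw [mul_pow b, ← pow_mul, ← pow_mul, har, pow_succ]
            ring
          rw [h4]
          exact h1.trans (by simpa using sub_dvd_pow_sub_pow (b * (y : S) ^ a) 1 r)
        have hbu : IsUnit (b ^ r * ((y : S) ^ p) ^ l) := by
          refine ((IsUnit.mul ?_ ?_).pow r).mul ((y.isUnit.pow p).pow l)
          · exact y.isUnit.map σ
          · exact (y⁻¹.isUnit).pow _
        obtain ⟨c, hc⟩ := hbu.exists_right_inv
        refine ⟨c, map_eq_self_of_mul_eq_one hc (by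
          rw [map_mul, map_pow, map_pow, hgb, hgu]), ?_⟩
        obtain ⟨t, ht⟩ := h3
        refine ⟨c * t, ?_⟩
        linear_combination c * ht - (y : S) * hc
      · obtain ⟨c, hgc, hc⟩ := ih (by omega)
        obtain ⟨d, hd⟩ := (hcunit c ((dvd_pow_self ϖ hj.ne').trans hc)).exists_right_inv
        have hgd : g d = d := map_eq_self_of_mul_eq_one hd hgc
        let y' : Sˣ := y * ⟨d, c, by rw [mul_comm, hd], hd⟩
        have hy' : (y' : S) = y * d := rfl
        obtain ⟨c', hgc', hc'⟩ := exists_invariant_dvd_sub_of_one_add hσg hσζ hϖT hϖ hσϖ hθ hσ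
          hj.ne' (hunit j hj.ne' (by omega)) y' (by rw [hy', map_mul, hgd, hy, mul_assoc]) (by
            obtain ⟨t, ht⟩ := hc
            exact ⟨t * d, by rw [hy']; linear_combination d * ht + hd⟩)
        refine ⟨c * c', by rw [map_mul, hgc, hgc'], ?_⟩
        obtain ⟨t, ht⟩ := hc'
        refine ⟨c * t, ?_⟩
        rw [hy'] at ht
        linear_combination c * ht - (y : S) * hd
  obtain ⟨c, hgc, z, hz⟩ := key m le_rfl
  refine ⟨z, ?_⟩
  have h1 : g z - z = w * y := by
    refine sub_eq_zero.mp (hpow m _ ?_)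
    have h2 := congrArg g hz
    rw [map_sub, map_mul, map_pow, hϖT, hgc, hy] at h2
    linear_combination hz - h2 + (y : S) * hζ1
  rw [h1]
  exact hw.mul y.isUnit

end TameDescent

/-! ### Tame inertia in the cyclotomic extension of a discrete valuation ring -/

section TameInertia

open IsLocalRing

/-- The degree of inseparability is a power of `p` dividing the degree. -/
theorem Algebra.isSeparable_of_not_dvd_finrank (F E : Type*) [Field F] [Field E] [Algebra F E]
    [FiniteDimensional F E] (p : ℕ) [Fact p.Prime] [CharP F p]
    (h : ¬ p ∣ Module.finrank F E) : Algebra.IsSeparable F E := by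
  have : ExpChar F p := .prime Fact.out
  rw [isSeparable_iff_finInsepDegree_eq_one]
  obtain ⟨n, hn⟩ := finInsepDegree_eq_pow F E p
  rw [hn]
  rcases n with - | n
  · rw [pow_zero]
  · exact absurd (Dvd.intro_left _ (Field.finSepDegree_mul_finInsepDegree F E))
      (fun h' => h ((dvd_pow_self p n.succ_ne_zero).trans (hn ▸ h')))

section Inertia

open Ideal

open scoped Pointwise

variable {A B G : Type*} [CommRing A] [IsDomain A] [CommRing B] [IsDomain B] [Algebra A B]
  [Group G] [MulSemiringAction G B] [IsGaloisGroup G A B] [Finite G] [Module.Finite A B]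
  [Module.Flat A B]

theorem inertiaDeg_dvd_card (𝔭 : Ideal A) (P : Ideal B) [P.LiesOver 𝔭] [𝔭.IsPrime] [P.IsPrime] :
    P.inertiaDeg A ∣ Nat.card G := by
  rw [← inertiaDegIn_eq_inertiaDeg 𝔭 P G,
    ← ncard_primesOver_mul_ramificationIdxIn_mul_inertiaDegIn 𝔭 B G]
  exact Dvd.intro_left _ (mul_assoc _ _ _)

theorem isSeparable_residueField_of_not_dvd (𝔭 : Ideal A) (P : Ideal B) [P.LiesOver 𝔭]
    [𝔭.IsMaximal] [P.IsMaximal] (p : ℕ) [Fact p.Prime] (hp : (p : A) ∈ 𝔭)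
    (hG : ¬ p ∣ Nat.card G) : Algebra.IsSeparable (A ⧸ 𝔭) (B ⧸ P) := by
  let _ : Field (A ⧸ 𝔭) := Ideal.Quotient.field 𝔭
  let _ : Field (B ⧸ P) := Ideal.Quotient.field P
  have : CharP (A ⧸ 𝔭) p := by
    obtain ⟨q, hq⟩ := CharP.exists (A ⧸ 𝔭)
    have h1 : q ∣ p := (CharP.cast_eq_zero_iff (A ⧸ 𝔭) q p).mp (by
      rw [← map_natCast (Ideal.Quotient.mk 𝔭)]
      exact Ideal.Quotient.eq_zero_iff_mem.mpr hp)
    rcases (Nat.dvd_prime Fact.out).mp h1 with rfl | rfl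
    · exact absurd rfl (CharP.char_ne_one (A ⧸ 𝔭) 1)
    · exact hq
  have : Module.Finite (A ⧸ 𝔭) (B ⧸ P) := inferInstance
  refine Algebra.isSeparable_of_not_dvd_finrank _ _ p fun h => hG ?_
  rw [← inertiaDeg_eq_of_isMaximal 𝔭 P] at h
  exact h.trans (inertiaDeg_dvd_card 𝔭 P)

/-- If the order of the Galois group is prime to the residue characteristic `p`, then the inertia
group has order equal to the ramification index, without any perfectness assumption. -/
theorem card_inertia_eq_ramificationIdx_of_not_dvd (𝔭 : Ideal A) (P : Ideal B) [P.LiesOver 𝔭]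
    [𝔭.IsMaximal] [P.IsMaximal] (p : ℕ) [Fact p.Prime] (hp : (p : A) ∈ 𝔭)
    (hG : ¬ p ∣ Nat.card G) :
    Nat.card (P.inertia G) = P.ramificationIdx A := by
  let _ : Field (A ⧸ 𝔭) := Ideal.Quotient.field 𝔭
  let _ : Field (B ⧸ P) := Ideal.Quotient.field P
  have : Algebra.IsSeparable (A ⧸ 𝔭) (B ⧸ P) := isSeparable_residueField_of_not_dvd 𝔭 P p hp hG
  have : IsGalois (A ⧸ 𝔭) (B ⧸ P) :=
    { __ := Ideal.Quotient.normal G 𝔭 P }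
  have hidx : (((P.inertia G).subgroupOf (MulAction.stabilizer G P))).index =
      Nat.card Gal((B ⧸ P)/(A ⧸ 𝔭)) := Nat.card_congr
    (IsFractionRing.stabilizerQuotientInertiaEquiv G 𝔭 P (A ⧸ 𝔭) (B ⧸ P)).toEquiv
  have hstab : Nat.card (MulAction.stabilizer G P) =
      Nat.card (P.inertia G) * P.inertiaDeg A := by
    rw [inertiaDeg_eq_of_isMaximal 𝔭 P, ← IsGalois.card_aut_eq_finrank, ← hidx,
      ← ((inertia G P).subgroupOf (MulAction.stabilizer G P)).card_mul_index,
      Nat.card_congr (Subgroup.subgroupOfEquivOfLe (inertia_le_stabilizer (M := G) P)).toEquiv]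
  have h1 : (𝔭.primesOver B).ncard * Nat.card (P.inertia G) * P.inertiaDeg A = Nat.card G := by
    rw [mul_assoc, ← hstab, ← Algebra.IsInvariant.orbit_eq_primesOver A B G 𝔭 P]
    simpa using Nat.card_congr (MulAction.orbitProdStabilizerEquivGroup G P)
  have h2 := ncard_primesOver_mul_ramificationIdxIn_mul_inertiaDegIn 𝔭 B G
  rw [inertiaDegIn_eq_inertiaDeg 𝔭 P G, ramificationIdxIn_eq_ramificationIdx 𝔭 P G, ← mul_assoc]
    at h2
  have h3 : P.inertiaDeg A ≠ 0 := (P.inertiaDeg_pos A).ne'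
  have h4 : (𝔭.primesOver B).ncard ≠ 0 := fun h => by
    rw [h, zero_mul, zero_mul] at h2
    exact Nat.card_pos.ne h2
  exact mul_left_cancel₀ h4 (mul_right_cancel₀ h3 (h1.trans h2.symm))

end Inertia

section Cyclotomic

open Ideal

open scoped Pointwise

/-- A Dedekind domain finite over a discrete valuation ring is semilocal, hence principal. -/
theorem isPrincipalIdealRing_of_finite (V W : Type*) [CommRing V] [IsDomain V]
    [IsDiscreteValuationRing V] [CommRing W] [IsDedekindDomain W] [Algebra V W]
    [Module.Finite V W] : IsPrincipalIdealRing W := by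
  refine IsPrincipalIdealRing.of_finite_maximals
    ((Algebra.QuasiFinite.finite_primesOver (S := W) (maximalIdeal V)).subset fun P hP => ?_)
  have : P.IsMaximal := hP
  have : (P.under V).IsMaximal := Ideal.IsMaximal.under V P
  exact ⟨hP.isPrime, ⟨(eq_maximalIdeal this).symm⟩⟩

theorem exponent_eq_of_mul_prime_pow_eq {W : Type*} [CommRing W] [IsDomain W] {ϖ x y : W}
    (hϖ : Prime ϖ)
    (hx : ¬ ϖ ∣ x) (hy : ¬ ϖ ∣ y) {m n : ℕ} (h : x * ϖ ^ m = y * ϖ ^ n) : m = n := by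
  have aux : ∀ {x y : W}, ¬ ϖ ∣ y → ∀ {m n : ℕ}, x * ϖ ^ m = y * ϖ ^ n → m ≤ n := by
    intro x y hy m n h
    by_contra! hlt
    obtain ⟨d, rfl⟩ := Nat.exists_eq_add_of_lt hlt
    refine hy ⟨x * ϖ ^ d, mul_right_cancel₀ (pow_ne_zero n hϖ.ne_zero) ?_⟩
    rw [← h]
    ring
  exact le_antisymm (aux hy h) (aux hx h.symm)

theorem IsPrimitiveRoot.exists_isUnit_mul_sub_one_pow {W : Type*} [CommRing W] [IsDomain W]
    {p : ℕ} (hp : p.Prime) {ζ : W} (hζ : IsPrimitiveRoot ζ p) :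
    ∃ u : W, IsUnit u ∧ (p : W) = u * (ζ - 1) ^ (p - 1) := by
  obtain ⟨n, rfl⟩ := Nat.exists_eq_add_one_of_ne_zero hp.ne_zero
  have hassoc : ∀ k ∈ Finset.range n, ∃ u : W, IsUnit u ∧ ζ ^ (k + 1) - 1 = u * (ζ - 1) := by
    intro k hk
    have hcop : (k + 1).Coprime (n + 1) :=
      (Nat.coprime_of_lt_prime k.succ_ne_zero (by simpa using hk) hp).symm
    obtain ⟨u, hu⟩ := hζ.associated_sub_one_pow_sub_one_of_coprime hcop
    exact ⟨u, u.isUnit, by rw [← hu, mul_comm]⟩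
  choose! u hu hu' using hassoc
  refine ⟨(-1) ^ n * ∏ k ∈ Finset.range n, u k, (isUnit_neg_one.pow n).mul
    (Finset.prod_induction _ IsUnit (fun _ _ => IsUnit.mul) isUnit_one hu), ?_⟩
  have h := hζ.prod_pow_sub_one_eq_order
  rw [Finset.prod_congr rfl hu', Finset.prod_mul_distrib, Finset.prod_const,
    Finset.card_range] at h
  rw [Nat.add_sub_cancel, Nat.cast_add, Nat.cast_one, ← h]
  ring

/-- The cyclotomic character embeds the group into the units of `ZMod p`. -/
theorem autToPow_toAlgAut_injective {V W G : Type*} [CommRing V] [CommRing W] [IsDomain W]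
    [Algebra V W] [Group G] [MulSemiringAction G W] [SMulCommClass G V W] {p : ℕ}
    [hp : Fact p.Prime] {ζ : W} (hζ : IsPrimitiveRoot ζ p) (hfaith : ∀ g : G, g • ζ = ζ → g = 1) :
    Function.Injective ((hζ.autToPow V).comp (MulSemiringAction.toAlgAut G V W)) := by
  rw [injective_iff_map_eq_one]
  intro g hg
  refine hfaith g ?_
  have h := hζ.autToPow_spec V (MulSemiringAction.toAlgAut G V W g)
  rw [MonoidHom.comp_apply] at hg
  rw [hg, Units.val_one, ZMod.val_one, pow_one] at h
  exact h.symm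

theorem not_dvd_card_of_faithful {V W G : Type*} [CommRing V] [CommRing W] [IsDomain W]
    [Algebra V W] [Group G] [MulSemiringAction G W] [SMulCommClass G V W] {p : ℕ}
    [hp : Fact p.Prime] {ζ : W} (hζ : IsPrimitiveRoot ζ p) (hfaith : ∀ g : G, g • ζ = ζ → g = 1) :
    ¬ p ∣ Nat.card G := by
  intro h
  have h1 := h.trans (Subgroup.card_dvd_of_injective _
    (autToPow_toAlgAut_injective (V := V) hζ hfaith))
  rw [Nat.card_eq_fintype_card, ZMod.card_units] at h1
  exact absurd (Nat.le_of_dvd (Nat.sub_pos_of_lt hp.out.one_lt) h1)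
    (by have := hp.out.pos; omega)

variable {V W : Type*} [CommRing V] [IsDomain V] [IsDiscreteValuationRing V] [CommRing W]
  [IsDedekindDomain W] [Algebra V W] [Module.Finite V W] [FaithfulSMul V W]
  {G : Type*} [Group G] [MulSemiringAction G W] [IsGaloisGroup G V W] [Finite G]

/-- Let `P` be a prime of `W = V[ζ_p]` above `p`, where the absolute ramification index `e` of `V`
is less than `p - 1`. Let `m` be the valuation of `ζ - 1` at `P`; it is smaller than the
ramification index `n` of `W / V`, because `e n = m (p - 1)`. A generator `σ` of the inertia group
acts on `ζ` through an exponent `a + 1` of order `n` modulo `p`, and on a uniformizer `ϖ` through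
`θ` with `θ ^ m = a + 1` modulo `P`. Hence `θ ^ j ≠ a + 1` modulo `P` for `0 < j < m`. -/
theorem exists_inertia_generator {p : ℕ} [hp : Fact p.Prime] {π w : V} (hπ : Irreducible π)
    (hw : IsUnit w) {e : ℕ} (he0 : e ≠ 0) (he : e < p - 1) (hpπ : (p : V) = w * π ^ e) {ζ : W}
    (hζ : IsPrimitiveRoot ζ p) (hfaith : ∀ g : G, g • ζ = ζ → g = 1) (P : Ideal W) [P.IsPrime]
    (hP : algebraMap V W π ∈ P) :
    ∃ (σ : G) (ϖ θ w₁ w₂ : W) (a r l m k : ℕ), P = span {ϖ} ∧ (∀ x : W, σ • x - x ∈ P) ∧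
      σ • ζ = ζ ^ (a + 1) ∧ a * r = p * l + 1 ∧ σ • ϖ = θ * ϖ ∧
      (∀ j, j ≠ 0 → j < m → θ ^ j - (a + 1 : ℕ) ∉ P) ∧
      ζ - 1 = w₁ * ϖ ^ m ∧ w₁ ∉ P ∧ (p : W) = w₂ * ϖ ^ k ∧ w₂ ∉ P := by
  have := isPrincipalIdealRing_of_finite V W
  have hinj : Function.Injective (algebraMap V W) := FaithfulSMul.algebraMap_injective V W
  have hπ0 : algebraMap V W π ≠ 0 := (map_ne_zero_iff _ hinj).mpr hπ.ne_zero
  have hP0 : P ≠ ⊥ := fun h => hπ0 (by rwa [h, mem_bot] at hP)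
  have hPmax : P.IsMaximal := IsPrime.isMaximal inferInstance hP0
  have hunder : P.under V = maximalIdeal V := eq_maximalIdeal (IsMaximal.under V P)
  have : P.LiesOver (maximalIdeal V) := ⟨hunder.symm⟩
  have hpP : (p : W) ∈ P := by
    rw [← map_natCast (algebraMap V W), hpπ, map_mul, map_pow]
    exact mul_mem_left _ _ (pow_mem_of_mem _ hP _ (Nat.pos_of_ne_zero he0))
  obtain ⟨ϖ, hPϖ⟩ : ∃ ϖ, P = span {ϖ} := (IsPrincipalIdealRing.principal P).principal
  have hϖ0 : ϖ ≠ 0 := fun h => hP0 (by rw [hPϖ, h, span_singleton_eq_bot])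
  have hϖ : Prime ϖ := (span_singleton_prime hϖ0).mp (hPϖ ▸ inferInstance)
  have hmem : ∀ x, x ∈ P ↔ ϖ ∣ x := fun x => by rw [hPϖ, mem_span_singleton]
  have hfac : ∀ x : W, x ≠ 0 → ∃ (n : ℕ) (y : W), ¬ ϖ ∣ y ∧ x = y * ϖ ^ n := by
    intro x hx
    obtain ⟨n, y, hy, hxy⟩ := WfDvdMonoid.max_power_factor hx hϖ.irreducible
    exact ⟨n, y, hy, by rw [hxy, mul_comm]⟩
  have hmul : ∀ {x y : W}, ¬ ϖ ∣ x → ¬ ϖ ∣ y → ¬ ϖ ∣ x * y := fun hx hy h =>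
    (hϖ.dvd_or_dvd h).elim hx hy
  obtain ⟨n, w₃, hw₃, hπn⟩ := hfac _ hπ0
  have hζ1 : ζ - 1 ≠ 0 := hζ.sub_one_ne_zero hp.out.one_lt
  obtain ⟨m, w₁, hw₁, hζm⟩ := hfac _ hζ1
  -- The two expressions of `p` give `e * n = m * (p - 1)`.
  have hpn : (p : W) = (algebraMap V W w * w₃ ^ e) * ϖ ^ (n * e) := by
    rw [← map_natCast (algebraMap V W), hpπ, map_mul, map_pow, hπn]
    ring
  have hunit : ∀ {x : W}, IsUnit x → ¬ ϖ ∣ x := fun hx h => hϖ.not_isUnit (isUnit_of_dvd_unit h hx)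
  have hw₂ : ¬ ϖ ∣ algebraMap V W w * w₃ ^ e :=
    hmul (hunit (hw.map _)) (fun h => hw₃ (hϖ.dvd_of_dvd_pow h))
  have hne : n * e = m * (p - 1) := by
    obtain ⟨u, hu, hpu⟩ := hζ.exists_isUnit_mul_sub_one_pow hp.out
    refine exponent_eq_of_mul_prime_pow_eq hϖ (y := u * w₁ ^ (p - 1)) hw₂
      (hmul (hunit hu) (fun h => hw₁ (hϖ.dvd_of_dvd_pow h))) ?_
    rw [← hpn, hpu, hζm]
    ring
  have hn0 : n ≠ 0 := by
    rintro rfl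
    rw [pow_zero, mul_one] at hπn
    exact hw₃ (hπn ▸ (hmem _).mp hP)
  have hm0 : m ≠ 0 := by
    rintro rfl
    rw [zero_mul] at hne
    exact (mul_ne_zero hn0 he0) hne
  have hmn : m < n := by
    by_contra! h
    have h1 : n * e < m * (p - 1) := lt_of_le_of_lt (Nat.mul_le_mul_right e h)
      (Nat.mul_lt_mul_of_pos_left he (Nat.pos_of_ne_zero hm0))
    omega
  have : SMulCommClass G V W := IsGaloisGroup.commutes
  let χ : G →* (ZMod p)ˣ := (hζ.autToPow V).comp (MulSemiringAction.toAlgAut G V W)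
  have hχ : ∀ g : G, ζ ^ (χ g : ZMod p).val = g • ζ := fun g => hζ.autToPow_spec V _
  have hχinj : Function.Injective χ := autToPow_toAlgAut_injective hζ hfaith
  have hcard : ¬ p ∣ Nat.card G := not_dvd_card_of_faithful (V := V) hζ hfaith
  have hcardI : Nat.card (P.inertia G) = n := by
    have hpm : (p : V) ∈ maximalIdeal V := by
      rw [hpπ]
      exact mul_mem_left _ _ (pow_mem_of_mem _ ((mem_maximalIdeal π).mpr hπ.not_isUnit) _
        (Nat.pos_of_ne_zero he0))
    have hmap : (maximalIdeal V).map (algebraMap V W) = span {algebraMap V W π} := by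
      rw [hπ.maximalIdeal_eq, map_span, Set.image_singleton]
    rw [card_inertia_eq_ramificationIdx_of_not_dvd (maximalIdeal V) P p hpm hcard,
      ← ramificationIdx'_eq_ramificationIdx' (maximalIdeal V) P (by
        rw [hmap, Ne, span_singleton_eq_bot]
        exact hπ0)]
    refine ramificationIdx'_spec ?_ ?_
    · rw [hmap, hPϖ, span_singleton_pow, span_singleton_le_span_singleton, hπn]
      exact dvd_mul_left _ _
    · rw [hmap, hPϖ, span_singleton_pow, span_singleton_le_span_singleton, hπn, mul_comm, pow_succ]
      exact fun h => hw₃ ((mul_dvd_mul_iff_left (pow_ne_zero n hϖ0)).mp h)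
  have : IsCyclic (P.inertia G) := isCyclic_of_injective (χ.comp (P.inertia G).subtype)
    (hχinj.comp Subtype.val_injective)
  obtain ⟨⟨σ, hσ⟩, hgen⟩ := IsCyclic.exists_generator (α := P.inertia G)
  have hσn : orderOf (χ σ) = n := by
    rw [orderOf_injective χ hχinj, ← hcardI, ← orderOf_eq_card_of_forall_mem_zpowers hgen,
      Subgroup.orderOf_mk]
  obtain ⟨a, ha⟩ : ∃ a, (χ σ : ZMod p).val = a + 1 :=
    Nat.exists_eq_add_one_of_ne_zero fun h => (χ σ).ne_zero ((ZMod.val_eq_zero _).mp h)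
  have hσζ : σ • ζ = ζ ^ (a + 1) := by rw [← ha, hχ]
  have haZ : ((a + 1 : ℕ) : ZMod p) = χ σ := by rw [← ha, ZMod.natCast_val, ZMod.cast_id]
  have ha0 : a ≠ 0 := by
    rintro rfl
    have h1 : χ σ = 1 := Units.ext (by rw [← haZ]; simp)
    rw [h1, orderOf_one] at hσn
    omega
  have hap : a.Coprime p := by
    refine (Nat.coprime_of_lt_prime ha0 ?_ hp.out).symm
    have := ZMod.val_lt (χ σ : ZMod p)
    omega
  obtain ⟨r, hr⟩ : ∃ r, a * r % p = 1 := by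
    obtain ⟨r, -, hr⟩ := Nat.exists_mul_mod_eq_one_of_coprime hap hp.out.one_lt
    exact ⟨r, hr⟩
  have hσP : ∀ x : W, σ • x - x ∈ P := hσ
  obtain ⟨θ, hθ⟩ : ϖ ∣ σ • ϖ := by
    rw [← hmem, ← sub_add_cancel (σ • ϖ) ϖ]
    exact P.add_mem (hσP ϖ) ((hmem ϖ).mpr dvd_rfl)
  -- Comparison of the actions on `ζ - 1` and on `ϖ ^ m`.
  have hθm : θ ^ m - (a + 1 : ℕ) ∈ P := by
    have h1 : σ • (ζ - 1) = (ζ - 1) * ∑ i ∈ Finset.range (a + 1), ζ ^ i := by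
      rw [smul_sub, smul_one, hσζ, mul_comm, geom_sum_mul]
    have h2 : σ • w₁ * θ ^ m = w₁ * ∑ i ∈ Finset.range (a + 1), ζ ^ i := by
      refine mul_left_cancel₀ (pow_ne_zero m hϖ0) ?_
      rw [hζm, smul_mul', smul_pow', hθ] at h1
      linear_combination h1
    have h3 : ∑ i ∈ Finset.range (a + 1), ζ ^ i - (a + 1 : ℕ) ∈ P := by
      have h4 : ∑ i ∈ Finset.range (a + 1), ζ ^ i - (a + 1 : ℕ) =
          ∑ i ∈ Finset.range (a + 1), (ζ ^ i - 1) := by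
        rw [Finset.sum_sub_distrib]
        simp
      rw [h4]
      refine P.sum_mem fun i _ => ?_
      have h5 : ζ - 1 ∣ ζ ^ i - 1 := by simpa using sub_dvd_pow_sub_pow ζ 1 i
      rw [hmem]
      exact ((dvd_pow_self ϖ hm0).trans (hζm ▸ dvd_mul_left _ _)).trans h5
    have h6 : w₁ * (θ ^ m - (a + 1 : ℕ)) ∈ P := by
      have h7 : w₁ * (θ ^ m - (a + 1 : ℕ)) = w₁ * (∑ i ∈ Finset.range (a + 1), ζ ^ i - (a + 1 : ℕ))
          - (σ • w₁ - w₁) * θ ^ m := by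
        linear_combination h2
      rw [h7]
      exact P.sub_mem (P.mul_mem_left _ h3) (P.mul_mem_right _ (hσP w₁))
    exact (IsPrime.mem_or_mem inferInstance h6).resolve_left fun h => hw₁ ((hmem _).mp h)
  refine ⟨σ, ϖ, θ, w₁, _, a, r, a * r / p, m, n * e, hPϖ, hσP, hσζ, ?_, by rw [hθ, mul_comm], ?_,
    hζm, fun h => hw₁ ((hmem _).mp h), hpn, fun h => hw₂ ((hmem _).mp h)⟩
  · have := Nat.div_add_mod (a * r) p
    rw [hr] at this
    exact this.symm
  · intro j hj0 hjm hj
    let _ : Field (W ⧸ P) := Ideal.Quotient.field P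
    have hchar : ∀ c : ℕ, (c : W ⧸ P) = 0 → p ∣ c := by
      intro c hc
      by_contra hpc
      have hcop : (c : ℤ).gcd p = 1 := by
        simpa using (Nat.Coprime.symm ((Nat.Prime.coprime_iff_not_dvd hp.out).mpr hpc))
      have h1 := congrArg (Int.cast : ℤ → W ⧸ P) (Int.gcd_eq_gcd_ab c p)
      have h2 : (p : W ⧸ P) = 0 := by
        rw [← map_natCast (Ideal.Quotient.mk P)]
        exact Ideal.Quotient.eq_zero_iff_mem.mpr hpP
      rw [hcop] at h1
      push_cast at h1
      rw [hc, h2, zero_mul, zero_mul, add_zero] at h1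
      exact one_ne_zero h1
    have ha1 : ((a + 1 : ℕ) : W ⧸ P) ≠ 0 := fun h => by
      have h1 := hchar _ h
      rw [← ZMod.natCast_eq_zero_iff, haZ] at h1
      exact (χ σ).ne_zero h1
    set t := Ideal.Quotient.mk P θ with ht
    have htm : t ^ m = (a + 1 : ℕ) := by
      have := Ideal.Quotient.eq_zero_iff_mem.mpr hθm
      rwa [map_sub, map_pow, map_natCast, sub_eq_zero] at this
    have htj : t ^ j = (a + 1 : ℕ) := by
      have := Ideal.Quotient.eq_zero_iff_mem.mpr hj
      rwa [map_sub, map_pow, map_natCast, sub_eq_zero] at this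
    have h1 : t ^ (m - j) = 1 := by
      refine mul_left_cancel₀ (a := t ^ j) (by rw [htj]; exact ha1) ?_
      rw [← pow_add, Nat.add_sub_cancel' hjm.le, htm, htj, mul_one]
    have h2 : ((a + 1 : ℕ) : W ⧸ P) ^ (m - j) = 1 := by
      rw [← htm, ← pow_mul, mul_comm, pow_mul, h1, one_pow]
    have h3 : p ∣ (a + 1) ^ (m - j) - 1 := by
      refine hchar _ ?_
      rw [Nat.cast_sub (Nat.one_le_pow _ _ a.succ_pos), Nat.cast_pow, h2, Nat.cast_one, sub_self]
    have h4 : χ σ ^ (m - j) = 1 := by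
      rw [← ZMod.natCast_eq_zero_iff, Nat.cast_sub (Nat.one_le_pow _ _ a.succ_pos), Nat.cast_pow,
        haZ, Nat.cast_one, sub_eq_zero] at h3
      exact Units.ext (by simpa using h3)
    have h5 := orderOf_dvd_of_pow_eq_one h4
    rw [hσn] at h5
    have := Nat.le_of_dvd (by omega) h5
    omega

end Cyclotomic

end TameInertia

/-! ### The rings `V` and `V[ζ_p]` -/

section Ramification

open IsLocalRing

variable (p : ℕ) [hp : Fact p.Prime]

theorem maximalIdeal_zLocalizedAt :
    maximalIdeal (ZLocalizedAt p) = Ideal.span {(p : ZLocalizedAt p)} := by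
  rw [← Localization.AtPrime.map_eq_maximalIdeal, Ideal.map_span, Set.image_singleton]
  simp

theorem charZero_of_faithfullyFlat (V : Type*) [CommRing V]
    [Algebra (ZLocalizedAt p) V] [Module.FaithfullyFlat (ZLocalizedAt p) V] : CharZero V := by
  have h1 : Function.Injective (algebraMap ℤ (ZLocalizedAt p)) :=
    IsLocalization.injective _ (Ideal.primeCompl_le_nonZeroDivisors (Ideal.span {(p : ℤ)}))
  have h2 : Function.Injective (algebraMap (ZLocalizedAt p) V) :=
    FaithfulSMul.algebraMap_injective _ _
  refine ⟨fun a b h => ?_⟩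
  have h3 : algebraMap (ZLocalizedAt p) V (algebraMap ℤ (ZLocalizedAt p) a) =
      algebraMap (ZLocalizedAt p) V (algebraMap ℤ (ZLocalizedAt p) b) := by
    simpa using h
  exact_mod_cast h1 (h2 h3)

theorem exists_natCast_eq_mul_pow (V : Type*) [CommRing V] [IsDomain V]
    [IsDiscreteValuationRing V] [Algebra (ZLocalizedAt p) V]
    [Module.FaithfullyFlat (ZLocalizedAt p) V] :
    ∃ (π w : V), Irreducible π ∧ IsUnit w ∧
      (maximalIdeal V).ramificationIdx (ZLocalizedAt p) ≠ 0 ∧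
      (p : V) = w * π ^ (maximalIdeal V).ramificationIdx (ZLocalizedAt p) := by
  have := charZero_of_faithfullyFlat p V
  have hp0 : (p : V) ≠ 0 := Nat.cast_ne_zero.mpr hp.out.ne_zero
  have hmap : (maximalIdeal (ZLocalizedAt p)).map (algebraMap (ZLocalizedAt p) V) =
      Ideal.span {(p : V)} := by
    rw [maximalIdeal_zLocalizedAt, Ideal.map_span, Set.image_singleton, map_natCast]
  have hpm : ¬ IsUnit (p : V) := by
    intro h
    have h1 := Ideal.comap_map_eq_self_of_faithfullyFlat (B := V) (maximalIdeal (ZLocalizedAt p))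
    rw [hmap, Ideal.span_singleton_eq_top.mpr h, Ideal.comap_top] at h1
    exact (IsLocalRing.maximalIdeal.isMaximal _).ne_top h1.symm
  obtain ⟨π, hπ⟩ := IsDiscreteValuationRing.exists_irreducible V
  obtain ⟨n, w, hw⟩ := IsDiscreteValuationRing.eq_unit_mul_pow_irreducible hp0 hπ
  have hover : (maximalIdeal V).LiesOver (maximalIdeal (ZLocalizedAt p)) := by
    have hle : (maximalIdeal (ZLocalizedAt p)) ≤ (maximalIdeal V).under (ZLocalizedAt p) := by
      rw [Ideal.under_def, ← Ideal.map_le_iff_le_comap, hmap, Ideal.span_singleton_le_iff_mem]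
      exact hpm
    exact ⟨(IsLocalRing.maximalIdeal.isMaximal _).eq_of_le
      (Ideal.IsPrime.under (ZLocalizedAt p) (maximalIdeal V)).ne_top hle⟩
  have hn : (maximalIdeal V).ramificationIdx (ZLocalizedAt p) = n := by
    rw [← Ideal.ramificationIdx'_eq_ramificationIdx' (maximalIdeal (ZLocalizedAt p))
      (maximalIdeal V) (by rwa [hmap, Ne, Ideal.span_singleton_eq_bot])]
    refine Ideal.ramificationIdx'_spec ?_ ?_
    · rw [hmap, hπ.maximalIdeal_eq, Ideal.span_singleton_pow,
        Ideal.span_singleton_le_span_singleton, hw]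
      exact dvd_mul_left _ _
    · rw [hmap, hπ.maximalIdeal_eq, Ideal.span_singleton_pow,
        Ideal.span_singleton_le_span_singleton, hw, mul_comm, pow_succ]
      exact fun h => hπ.not_isUnit (isUnit_of_dvd_unit
        ((mul_dvd_mul_iff_left (pow_ne_zero n hπ.ne_zero)).mp h) w.isUnit)
  refine ⟨π, w, hπ, w.isUnit, ?_, by rw [hn, hw]⟩
  rw [hn]
  rintro rfl
  rw [pow_zero, mul_one] at hw
  exact hpm (hw ▸ w.isUnit)

end Ramification

section AdjoinRootOfUnity

theorem charZero_fractionRing (V : Type*) [CommRing V] [CharZero V] : CharZero (FractionRing V) :=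
  charZero_of_injective_algebraMap (IsFractionRing.injective V (FractionRing V))

variable (p : ℕ) (V : Type*) [CommRing V] [IsDomain V] [CharZero V]

theorem finite_adjoinRootOfUnity [NeZero p] [IsDiscreteValuationRing V] :
    Module.Finite V (AdjoinRootOfUnity V p) := by
  have := charZero_fractionRing V
  have : FiniteDimensional (FractionRing V) (CyclotomicField p (FractionRing V)) :=
    IsCyclotomicExtension.finiteDimensional {p} _ _
  exact IsIntegralClosure.finite V (FractionRing V) (CyclotomicField p (FractionRing V)) _

theorem isDedekindDomain_adjoinRootOfUnity [NeZero p] [IsDiscreteValuationRing V] :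
    IsDedekindDomain (AdjoinRootOfUnity V p) := by
  have := charZero_fractionRing V
  have : FiniteDimensional (FractionRing V) (CyclotomicField p (FractionRing V)) :=
    IsCyclotomicExtension.finiteDimensional {p} _ _
  exact integralClosure.isDedekindDomain V (FractionRing V) (CyclotomicField p (FractionRing V))

theorem isGaloisGroup_adjoinRootOfUnity [NeZero p] [IsDiscreteValuationRing V] :
    IsGaloisGroup Gal(CyclotomicField p (FractionRing V)/FractionRing V) V
      (AdjoinRootOfUnity V p) := by
  have := charZero_fractionRing V
  have : FiniteDimensional (FractionRing V) (CyclotomicField p (FractionRing V)) :=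
    IsCyclotomicExtension.finiteDimensional {p} _ _
  have : IsGalois (FractionRing V) (CyclotomicField p (FractionRing V)) :=
    IsCyclotomicExtension.isGalois {p} _ _
  have : IsFractionRing (AdjoinRootOfUnity V p) (CyclotomicField p (FractionRing V)) :=
    integralClosure.isFractionRing_of_finite_extension (FractionRing V) _
  exact IsGaloisGroup.of_isFractionRing _ V _ (FractionRing V) (CyclotomicField p (FractionRing V))

theorem exists_isPrimitiveRoot_adjoinRootOfUnity [hp : Fact p.Prime] :
    ∃ ζ : AdjoinRootOfUnity V p, IsPrimitiveRoot ζ p ∧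
      ∀ g : Gal(CyclotomicField p (FractionRing V)/FractionRing V), g • ζ = ζ → g = 1 := by
  have := charZero_fractionRing V
  have hζ := IsCyclotomicExtension.zeta_spec p (FractionRing V) (CyclotomicField p (FractionRing V))
  set z := IsCyclotomicExtension.zeta p (FractionRing V) (CyclotomicField p (FractionRing V))
  refine ⟨⟨z, IsIntegral.of_pow hp.out.pos (hζ.pow_eq_one ▸ isIntegral_one)⟩, ?_, fun g hg => ?_⟩
  · exact IsPrimitiveRoot.coe_submonoidClass_iff.mp hζ
  · have h1 : g z = z := congrArg Subtype.val hg
    exact IsCyclotomicExtension.algEquiv_eq_of_apply_eq {p} _ _ fun n hn _ =>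
      ⟨z, (Set.mem_singleton_iff.mp hn) ▸ hζ, h1⟩

end AdjoinRootOfUnity

/-! ### Base change along `V → V[ζ_p]` -/

section BaseChange

/-- If `V → κ` is surjective and `R / (ker) R` is reduced, then so is its base change to a finite
separable extension of `κ`: it embeds into a product of the algebras `F ⊗[κ] κ₁`, where `F` runs
over the residue fields of `R / (ker) R`. -/
theorem isReduced_tensorProduct_of_isSeparable {V R κ κ₁ : Type*} [CommRing V] [CommRing R]
    [Algebra V R] [Field κ] [Algebra V κ] [Field κ₁] [Algebra κ κ₁] [Algebra V κ₁]
    [IsScalarTower V κ κ₁] [Algebra.IsSeparable κ κ₁] [FiniteDimensional κ κ₁]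
    (hsurj : Function.Surjective (algebraMap V κ))
    (hrad : ((RingHom.ker (algebraMap V κ)).map (algebraMap V R)).IsRadical) :
    IsReduced (R ⊗[V] κ₁) := by
  let b := Module.finBasis κ κ₁
  have hspan : ∀ x : R ⊗[V] κ₁, ∃ r : Fin _ → R, x = ∑ i, r i ⊗ₜ[V] b i := by
    intro x
    induction x with
    | zero => exact ⟨0, by simp⟩
    | add x y hx hy =>
      obtain ⟨r, rfl⟩ := hx
      obtain ⟨s, rfl⟩ := hy
      exact ⟨r + s, by simp [TensorProduct.add_tmul, Finset.sum_add_distrib]⟩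
    | tmul r y =>
      choose c hc using fun i => hsurj (b.repr y i)
      refine ⟨fun i => c i • r, ?_⟩
      conv_lhs => rw [← b.sum_repr y]
      rw [TensorProduct.tmul_sum]
      refine Finset.sum_congr rfl fun i _ => ?_
      rw [TensorProduct.smul_tmul, ← hc, algebraMap_smul]
  refine ⟨fun x hx => ?_⟩
  obtain ⟨r, rfl⟩ := hspan x
  have hmem : ∀ i, r i ∈ (RingHom.ker (algebraMap V κ)).map (algebraMap V R) := by
    intro i
    rw [← hrad.radical, Ideal.radical_eq_sInf, Ideal.mem_sInf]
    rintro 𝔮 ⟨hle, h𝔮⟩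
    let F := FractionRing (R ⧸ 𝔮)
    let f : κ →+* F := (Ideal.Quotient.lift (RingHom.ker (algebraMap V κ)) (algebraMap V F)
      fun a ha => by
        rw [IsScalarTower.algebraMap_apply V R F, IsScalarTower.algebraMap_apply R (R ⧸ 𝔮) F]
        rw [show algebraMap R (R ⧸ 𝔮) (algebraMap V R a) = 0 from
          Ideal.Quotient.eq_zero_iff_mem.mpr (hle (Ideal.mem_map_of_mem _ ha)), map_zero]).comp
      (RingHom.quotientKerEquivOfSurjective hsurj).symm.toRingHom
    let _ : Algebra κ F := f.toAlgebra
    have : IsScalarTower V κ F := .of_algebraMap_eq fun a => by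
      change _ = f (algebraMap V κ a)
      have : (RingHom.quotientKerEquivOfSurjective hsurj).symm (algebraMap V κ a) =
          Ideal.Quotient.mk _ a := by
        rw [RingEquiv.symm_apply_eq]
        rfl
      simp [f, this]
    have : IsReduced (F ⊗[κ] κ₁) := by
      have : Algebra.FormallyUnramified κ κ₁ := .of_isSeparable κ κ₁
      exact Algebra.FormallyUnramified.isReduced_of_field F _
    let ψ : R ⊗[V] κ₁ →ₐ[V] F ⊗[κ] κ₁ := Algebra.TensorProduct.lift
      ((Algebra.TensorProduct.includeLeft (R := κ) (S := κ) (A := F)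
        (B := κ₁)).restrictScalars V |>.comp (IsScalarTower.toAlgHom V R F))
      ((Algebra.TensorProduct.includeRight (R := κ) (A := F) (B := κ₁)).restrictScalars V)
      fun _ _ => Commute.all _ _
    have h0 : ψ (∑ i, r i ⊗ₜ[V] b i) = 0 := (hx.map ψ).eq_zero
    have h1 : ∑ i, algebraMap R F (r i) • Algebra.TensorProduct.basis F b i = 0 := by
      rw [← h0, map_sum]
      refine Finset.sum_congr rfl fun i _ => ?_
      simp [ψ, Algebra.smul_def]
    have h2 := Fintype.linearIndependent_iff.mp (Algebra.TensorProduct.basis F b).linearIndependent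
      _ h1 i
    rw [IsScalarTower.algebraMap_apply R (R ⧸ 𝔮) F] at h2
    exact Ideal.Quotient.eq_zero_iff_mem.mp
      ((map_eq_zero_iff _ (IsFractionRing.injective (R ⧸ 𝔮) F)).mp h2)
  refine Finset.sum_eq_zero fun i _ => ?_
  refine Submodule.span_induction (p := fun s _ => s ⊗ₜ[V] b i = 0) ?_ (TensorProduct.zero_tmul _ _)
    (fun s t _ _ hs ht => by rw [TensorProduct.add_tmul, hs, ht, add_zero]) ?_ (hmem i)
  · rintro _ ⟨a, ha, rfl⟩
    rw [Algebra.algebraMap_eq_smul_one, TensorProduct.smul_tmul, ← algebraMap_smul κ,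
      (RingHom.mem_ker).mp ha, zero_smul, TensorProduct.tmul_zero]
  · intro c s _ hs
    have := congrArg (fun y => (c ⊗ₜ[V] (1 : κ₁)) * y) hs
    simpa using this

/-- If the residue extension of `P` is separable and `R / 𝔪 R` is reduced, then
`R ⊗ W / P (R ⊗ W)` is reduced. -/
theorem isRadical_map_includeRight {V R W : Type*} [CommRing V] [CommRing R] [CommRing W]
    [Algebra V R] [Algebra V W] [Module.Finite V W] (𝔪 : Ideal V) [𝔪.IsMaximal] (P : Ideal W)
    [P.IsMaximal] [P.LiesOver 𝔪] [Algebra.IsSeparable (V ⧸ 𝔪) (W ⧸ P)]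
    (hrad : (𝔪.map (algebraMap V R)).IsRadical) :
    (P.map (Algebra.TensorProduct.includeRight : W →ₐ[V] R ⊗[V] W)).IsRadical := by
  let _ : Field (V ⧸ 𝔪) := Ideal.Quotient.field 𝔪
  let _ : Field (W ⧸ P) := Ideal.Quotient.field P
  have : IsReduced (R ⊗[V] (W ⧸ P)) := by
    refine isReduced_tensorProduct_of_isSeparable (κ := V ⧸ 𝔪) Ideal.Quotient.mk_surjective ?_
    rwa [Ideal.Quotient.algebraMap_eq, Ideal.mk_ker]
  have h := Algebra.TensorProduct.lTensor_ker (A := R) (Ideal.Quotient.mkₐ V P)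
    (Ideal.Quotient.mkₐ_surjective V P)
  have hker : RingHom.ker (Ideal.Quotient.mkₐ V P) = P := Ideal.Quotient.mkₐ_ker V P
  rw [hker] at h
  rw [← h, RingHom.ker_isRadical_iff_reduced_of_surjective]
  · exact this
  · exact TensorProduct.map_surjective Function.surjective_id (Ideal.Quotient.mkₐ_surjective V P)

end BaseChange

section FixedRing

variable {B A : Type*} [CommRing B] [CommRing A] [Algebra A B] {g : B →+* B} {p : ℕ}

theorem map_prod_iterate (hp : p ≠ 0) (hg : ∀ x, g^[p] x = x) (x : B) :
    g (∏ i ∈ Finset.range p, g^[i] x) = ∏ i ∈ Finset.range p, g^[i] x := by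
  obtain ⟨n, rfl⟩ := Nat.exists_eq_add_one_of_ne_zero hp
  rw [map_prod, Finset.prod_range_succ, Finset.prod_range_succ']
  simp only [← Function.iterate_succ_apply' g, hg, Function.iterate_zero_apply]

variable (𝔓 : Ideal B) [𝔓.IsPrime] (hgP : ∀ x, g x - x ∈ 𝔓)

/-- The ring of elements of `B_𝔓` fixed by an automorphism `g` of finite order in the inertia group
of `𝔓` is the localization of the ring `A` of fixed elements of `B`. -/
theorem exists_ringEquiv_eqLocus (hp : p ≠ 0) (hg : ∀ x, g^[p] x = x)
    (hinj : Function.Injective (algebraMap A B))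
    (hA : ∀ x, g x = x ↔ ∃ a, algebraMap A B a = x) :
    Nonempty (Localization.AtPrime (𝔓.under A) ≃+*
      (inertialMap 𝔓 g hgP).eqLocus (RingHom.id _)) := by
  -- Denominators outside `𝔓` may be replaced by their norms, which come from `A`.
  have hnorm : ∀ t ∉ 𝔓, ∃ s : (𝔓.under A).primeCompl, ∃ c, algebraMap A B s = t * c := by
    intro t ht
    obtain ⟨s, hs⟩ := (hA _).mp (map_prod_iterate hp hg t)
    have hiter : ∀ i, g^[i] t - t ∈ 𝔓 := by
      intro i
      induction i with
      | zero => simp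
      | succ i ih =>
        rw [Function.iterate_succ_apply', ← sub_add_sub_cancel _ (g^[i] t)]
        exact 𝔓.add_mem (hgP _) ih
    refine ⟨⟨s, fun h => ?_⟩, ?_⟩
    · have h1 : algebraMap A B s ∈ 𝔓 := h
      rw [hs, Ideal.IsPrime.prod_mem_iff] at h1
      obtain ⟨i, -, hi⟩ := h1
      exact ht ((𝔓.sub_mem_iff_right hi).mp (hiter i) )
    · obtain ⟨n, rfl⟩ := Nat.exists_eq_add_one_of_ne_zero hp
      exact ⟨∏ i ∈ Finset.range n, g^[i + 1] t, by rw [hs, Finset.prod_range_succ', mul_comm]; rfl⟩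
  let φ : Localization.AtPrime (𝔓.under A) →+* Localization.AtPrime 𝔓 :=
    Localization.localRingHom _ 𝔓 (algebraMap A B) rfl
  have hφ : ∀ a, φ (algebraMap A _ a) = algebraMap B _ (algebraMap A B a) :=
    Localization.localRingHom_to_map _ 𝔓 (algebraMap A B) rfl
  have hφinj : Function.Injective φ := by
    rw [injective_iff_map_eq_zero]
    intro x hx
    obtain ⟨a, s, rfl⟩ := IsLocalization.exists_mk'_eq (𝔓.under A).primeCompl x
    rw [IsLocalization.mk'_eq_zero_iff]
    have h1 : algebraMap B (Localization.AtPrime 𝔓) (algebraMap A B a) = 0 := by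
      rw [← hφ, ← IsLocalization.mk'_spec' _ a s, map_mul, hx, mul_zero]
    obtain ⟨t, ht⟩ := (IsLocalization.map_eq_zero_iff 𝔓.primeCompl _ _).mp h1
    obtain ⟨s, c, hs⟩ := hnorm t t.2
    refine ⟨s, hinj ?_⟩
    rw [map_mul, hs, mul_right_comm, ht, zero_mul, map_zero]
  have hmem : ∀ x, φ x ∈ (inertialMap 𝔓 g hgP).eqLocus (RingHom.id _) := by
    intro x
    have : (inertialMap 𝔓 g hgP).comp φ = φ := by
      refine IsLocalization.ringHom_ext (𝔓.under A).primeCompl (RingHom.ext fun a => ?_)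
      simp only [RingHom.comp_apply, hφ, inertialMap_algebraMap]
      rw [(hA _).mpr ⟨a, rfl⟩]
    exact RingHom.congr_fun this x
  refine ⟨RingEquiv.ofBijective (φ.codRestrict _ hmem) ⟨fun x y h => hφinj (congrArg Subtype.val h),
    ?_⟩⟩
  rintro ⟨x, hx⟩
  have hx' : inertialMap 𝔓 g hgP x = x := hx
  obtain ⟨b, t, rfl⟩ := IsLocalization.exists_mk'_eq 𝔓.primeCompl x
  obtain ⟨s, c, hs⟩ := hnorm t t.2
  have h1 : algebraMap B (Localization.AtPrime 𝔓) (algebraMap A B s) *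
      IsLocalization.mk' _ b t = algebraMap B _ (b * c) := by
    rw [hs, map_mul, mul_right_comm, IsLocalization.mk'_spec', map_mul]
  have h2 : algebraMap B (Localization.AtPrime 𝔓) (g (b * c)) = algebraMap B _ (b * c) := by
    have := congrArg (inertialMap 𝔓 g hgP) h1
    rw [map_mul, hx', inertialMap_algebraMap, inertialMap_algebraMap, (hA _).mpr ⟨s, rfl⟩,
      h1] at this
    exact this.symm
  obtain ⟨u, hu⟩ := (IsLocalization.eq_iff_exists 𝔓.primeCompl _).mp h2
  obtain ⟨s', c', hs'⟩ := hnorm u u.2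
  obtain ⟨a, ha⟩ := (hA (algebraMap A B s' * (b * c))).mp (by
    rw [map_mul, (hA _).mpr ⟨s', rfl⟩, hs', mul_right_comm, hu, mul_right_comm])
  refine ⟨IsLocalization.mk' _ a (s' * s), Subtype.ext ?_⟩
  change φ _ = _
  have h3 : IsUnit (φ (algebraMap A _ (s' * s : (𝔓.under A).primeCompl))) :=
    (IsLocalization.map_units _ (s' * s)).map φ
  refine h3.mul_left_cancel ?_
  rw [← map_mul, IsLocalization.mk'_spec', hφ, hφ, ha, Submonoid.coe_mul, map_mul, ← h1, map_mul,
    map_mul, mul_assoc]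

theorem isDomain_and_uniqueFactorizationMonoid_eqLocus (hp : p ≠ 0) (hg : ∀ x, g^[p] x = x)
    (hinj : Function.Injective (algebraMap A B))
    (hA : ∀ x, g x = x ↔ ∃ a, algebraMap A B a = x) (hfac : IsLocallyFactorial A) :
    ∃ _ : IsDomain ((inertialMap 𝔓 g hgP).eqLocus (RingHom.id _)),
      UniqueFactorizationMonoid ((inertialMap 𝔓 g hgP).eqLocus (RingHom.id _)) := by
  obtain ⟨E⟩ := exists_ringEquiv_eqLocus (A := A) 𝔓 hgP hp hg hinj hA
  obtain ⟨h1, h2⟩ := hfac (𝔓.under A)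
  have := E.symm.toMulEquiv.isDomain (Localization.AtPrime (𝔓.under A))
  exact ⟨this, E.toMulEquiv.uniqueFactorizationMonoid h2⟩

end FixedRing

section Resolvents

/-- Dedekind's independence of characters: at a prime where the powers of `g` are distinct modulo
`Q`, some Lagrange resolvent does not vanish. -/
theorem mem_radical_span_range_lagrangeResolvent {S : Type*} [CommRing S] {g : S →+* S} {p : ℕ}
    (hp : p ≠ 0) {c : S} (ζ : S) (hdist : ∀ Q : Ideal S, Q.IsPrime → c ∉ Q →
      ∀ i j, i < j → j < p → ∃ b, g^[i] b - g^[j] b ∉ Q) :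
    c ∈ (Ideal.span (Set.range (lagrangeResolvent g p ζ))).radical := by
  rw [Ideal.radical_eq_sInf, Ideal.mem_sInf]
  rintro Q ⟨hle, hQ⟩
  by_contra hc
  let φ : Fin p → (S →* S ⧸ Q) := fun i => ((Ideal.Quotient.mk Q).comp (g ^ (i : ℕ))).toMonoidHom
  have hφ : ∀ i b, φ i b = Ideal.Quotient.mk Q (g^[i] b) := fun i b => by
    simp [φ, RingHom.coe_pow]
  have hφinj : Function.Injective φ := by
    have aux : ∀ i j : Fin p, i < j → φ i ≠ φ j := by
      intro i j hij h
      obtain ⟨b, hb⟩ := hdist Q hQ hc i j hij j.2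
      refine hb (Ideal.Quotient.eq.mp ?_)
      rw [← hφ, ← hφ, h]
    intro i j h
    rcases lt_trichotomy i j with hij | hij | hij
    · exact absurd h (aux i j hij)
    · exact hij
    · exact absurd h.symm (aux j i hij)
  have hli := (linearIndependent_monoidHom S (S ⧸ Q)).comp φ hφinj
  have h0 : ∑ i : Fin p, Ideal.Quotient.mk Q (ζ ^ (i : ℕ)) • (φ i : S → S ⧸ Q) = 0 := by
    funext b
    have h1 : lagrangeResolvent g p ζ b ∈ Q := hle (Ideal.subset_span ⟨b, rfl⟩)
    have h2 := Ideal.Quotient.eq_zero_iff_mem.mpr h1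
    rw [lagrangeResolvent, Finset.sum_range, map_sum] at h2
    simpa [Finset.sum_apply, hφ] using h2
  have h1 := Fintype.linearIndependent_iff.mp hli _ h0 ⟨0, Nat.pos_of_ne_zero hp⟩
  simp at h1

end Resolvents

/-! ### Groups of order `p` -/

section OrderP

open IsLocalRing

theorem Ideal.IsRadical.map_localization {B : Type*} [CommRing B] {I : Ideal B} (hI : I.IsRadical)
    (M : Submonoid B) (S : Type*) [CommRing S] [Algebra B S] [IsLocalization M S] :
    (I.map (algebraMap B S)).IsRadical := by
  rintro x ⟨n, hn⟩
  obtain ⟨b, t, rfl⟩ := IsLocalization.exists_mk'_eq M x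
  have h1 : algebraMap B S (b ^ n) ∈ I.map (algebraMap B S) := by
    have h2 : algebraMap B S (b ^ n) =
        IsLocalization.mk' S b t ^ n * algebraMap B S (t : B) ^ n := by
      rw [← mul_pow, IsLocalization.mk'_spec, map_pow]
    rw [h2]
    exact Ideal.mul_mem_right _ _ hn
  obtain ⟨⟨a, s⟩, has⟩ := (IsLocalization.mem_map_algebraMap_iff M S).mp h1
  rw [← map_mul] at has
  obtain ⟨u, hu⟩ := (IsLocalization.eq_iff_exists M S).mp has
  have h3 : u * s * b ∈ I := by
    refine hI ⟨n + 1, ?_⟩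
    have h4 : (u * s * b : B) ^ (n + 1) = (u * s) ^ n * b * (u * (b ^ n * s)) := by ring
    rw [h4, hu]
    exact I.mul_mem_left _ (I.mul_mem_left _ a.2)
  have h5 := Ideal.mem_map_of_mem (algebraMap B S) h3
  rw [map_mul] at h5
  have h6 := (Ideal.unit_mul_mem_iff_mem _ (IsLocalization.map_units S (u * s))).mp h5
  rw [IsLocalization.mk'_eq_mul_mk'_one]
  exact Ideal.mul_mem_right _ _ h6

variable {V R W : Type*} [CommRing V] [CommRing R] [Algebra V R] [CommRing W] [Algebra V W]

theorem TensorProduct.map_sub_mem (f : R →ₐ[V] R) (h : W →ₐ[V] W) (I : Ideal (R ⊗[V] W))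
    (hf : ∀ r, (f r - r) ⊗ₜ[V] (1 : W) ∈ I) (hh : ∀ x, (1 : R) ⊗ₜ[V] (h x - x) ∈ I)
    (y : R ⊗[V] W) : Algebra.TensorProduct.map f h y - y ∈ I := by
  induction y with
  | zero => simp
  | add y z hy hz =>
    rw [map_add, add_sub_add_comm]
    exact I.add_mem hy hz
  | tmul r x =>
    have h1 : Algebra.TensorProduct.map f h (r ⊗ₜ[V] x) - r ⊗ₜ[V] x =
        (1 : R) ⊗ₜ[V] h x * (f r - r) ⊗ₜ[V] (1 : W) +
          r ⊗ₜ[V] (1 : W) * (1 : R) ⊗ₜ[V] (h x - x) := by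
      simp [TensorProduct.tmul_sub, TensorProduct.sub_tmul, mul_sub]
    rw [h1]
    exact I.add_mem (I.mul_mem_left _ (hf r)) (I.mul_mem_left _ (hh x))

/-- Invariants commute with the free base change `V → W`. -/
theorem map_toAlgHom_eq_self_iff {C : Type*} [Group C] [MulSemiringAction C R]
    [SMulCommClass C V R] [Module.Free V W] [Module.Finite V W] {g : C}
    (hg : ∀ h : C, h ∈ Subgroup.zpowers g) (x : R ⊗[V] W) :
    Algebra.TensorProduct.map (MulSemiringAction.toAlgHom V R g) (AlgHom.id V W) x = x ↔
      ∃ a, Algebra.TensorProduct.map (FixedPoints.subalgebra V R C).val (AlgHom.id V W) a = x := by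
  constructor
  · intro hx
    let b := Module.Free.chooseBasis V W
    let bB := Algebra.TensorProduct.basis R b
    have hsum : x = ∑ i, bB.repr x i ⊗ₜ[V] b i := by
      conv_lhs => rw [← bB.sum_repr x]
      refine Finset.sum_congr rfl fun i _ => ?_
      simp [bB, TensorProduct.smul_tmul']
    have hsum' : x = ∑ i, (g • bB.repr x i) • bB i := by
      conv_lhs => rw [← hx, hsum]
      rw [map_sum]
      refine Finset.sum_congr rfl fun i _ => ?_
      simp [bB, TensorProduct.smul_tmul']
    have hfix : ∀ i, g • bB.repr x i = bB.repr x i := by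
      intro i
      conv_rhs => rw [hsum', bB.repr_sum_self]
    have hfix' : ∀ i, ∀ h : C, h • bB.repr x i = bB.repr x i := fun i h =>
      (Subgroup.zpowers_le (H := MulAction.stabilizer C (bB.repr x i))).mpr (hfix i) (hg h)
    refine ⟨∑ i, (⟨bB.repr x i, hfix' i⟩ : FixedPoints.subalgebra V R C) ⊗ₜ[V] b i, ?_⟩
    rw [map_sum]
    conv_rhs => rw [hsum]
    rfl
  · rintro ⟨a, rfl⟩
    induction a with
    | zero => simp
    | add a b ha hb => rw [map_add, map_add, ha, hb]
    | tmul r x =>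
      have h1 : g • (r : R) = r := r.2 g
      simp [h1]

variable {C : Type*} [Group C] [MulSemiringAction C R] [SMulCommClass C V R]

theorem map_toAlgHom_one (x : R ⊗[V] W) :
    Algebra.TensorProduct.map (MulSemiringAction.toAlgHom V R (1 : C)) (AlgHom.id V W) x = x := by
  have h : MulSemiringAction.toAlgHom V R (1 : C) = AlgHom.id V R :=
    AlgHom.ext fun r => one_smul C r
  rw [h, Algebra.TensorProduct.map_id, AlgHom.id_apply]

theorem map_toAlgHom_iterate (g : C) (n : ℕ) (x : R ⊗[V] W) :
    (Algebra.TensorProduct.map (MulSemiringAction.toAlgHom V R g) (AlgHom.id V W))^[n] x =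
      Algebra.TensorProduct.map (MulSemiringAction.toAlgHom V R (g ^ n)) (AlgHom.id V W) x := by
  induction n with
  | zero =>
    rw [pow_zero, map_toAlgHom_one, Function.iterate_zero_apply]
  | succ n ih =>
    rw [Function.iterate_succ_apply', ih]
    clear ih
    induction x with
    | zero => simp
    | add x y hx hy => rw [map_add, map_add, map_add, hx, hy]
    | tmul r x => simp [pow_succ', mul_smul]

end OrderP

section Main

open IsLocalRing

variable {V : Type u} [CommRing V] [IsDomain V] [IsDiscreteValuationRing V]
  {R : Type v} [CommRing R] [Algebra V R] [IsRegularRing R]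
  {C : Type*} [Group C] [MulSemiringAction C R] [SMulCommClass C V R]
  {W : Type*} [CommRing W] [IsDedekindDomain W] [Algebra V W] [Module.Finite V W]
  [FaithfulSMul V W] {G : Type*} [Group G] [MulSemiringAction G W] [IsGaloisGroup G V W] [Finite G]

/-- Freeness for a group of order `p`. Here `W` and `G` stand for `V[ζ_p]` and its Galois group
over `V`. -/
theorem IsPointwiseFormallySmooth.eq_one_of_card_eq (hR : IsPointwiseFormallySmooth V R) {p : ℕ}
    [hp : Fact p.Prime] {π w : V} (hπ : Irreducible π) (hw : IsUnit w) {e : ℕ} (he0 : e ≠ 0)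
    (he : e < p - 1) (hpπ : (p : V) = w * π ^ e) {ζ : W} (hζ : IsPrimitiveRoot ζ p)
    (hfaith : ∀ g : G, g • ζ = ζ → g = 1) (hC : Nat.card C = p)
    (hfree : ∀ 𝔮 : Ideal R, 𝔮.IsPrime → (p : R) ∉ 𝔮 → ∀ g : C, (∀ x : R, g • x - x ∈ 𝔮) → g = 1)
    (hfac : IsLocallyFactorial (FixedPoints.subalgebra V R C ⊗[V] W)) (𝔭 : Ideal R) [𝔭.IsPrime]
    (h𝔭 : algebraMap V R π ∈ 𝔭) {g : C} (hg : ∀ x : R, g • x - x ∈ 𝔭) : g = 1 := by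
  by_contra hg1
  have : SMulCommClass G V W := IsGaloisGroup.commutes
  have hgen : ∀ h : C, h ∈ Subgroup.zpowers g := fun h => mem_zpowers_of_prime_card hC hg1
  have hord : orderOf g = p := by
    rw [orderOf_eq_card_of_forall_mem_zpowers hgen, hC]
  -- A prime `𝔓` of `R ⊗ W` above `𝔭`, and the prime `P` of `W` below it.
  obtain ⟨⟨𝔓, h𝔓⟩, h𝔓𝔭⟩ := PrimeSpectrum.comap_surjective_of_faithfullyFlat
    (A := R) (B := R ⊗[V] W) ⟨𝔭, inferInstance⟩
  have hmem𝔓 : ∀ r : R, r ⊗ₜ[V] (1 : W) ∈ 𝔓 ↔ r ∈ 𝔭 := fun r => by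
    have := congrArg (fun q : PrimeSpectrum R => r ∈ q.asIdeal) h𝔓𝔭
    exact iff_of_eq this
  let incl : W →ₐ[V] R ⊗[V] W := Algebra.TensorProduct.includeRight
  let P : Ideal W := 𝔓.comap incl
  have hPprime : P.IsPrime := inferInstance
  have hπP : algebraMap V W π ∈ P := by
    change incl (algebraMap V W π) ∈ 𝔓
    rw [AlgHom.commutes, Algebra.TensorProduct.algebraMap_apply]
    exact (hmem𝔓 _).mpr h𝔭
  have hP0 : P ≠ ⊥ := fun h => by
    rw [h, Ideal.mem_bot, FaithfulSMul.algebraMap_eq_zero_iff] at hπP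
    exact hπ.ne_zero hπP
  have hPmax : P.IsMaximal := Ideal.IsPrime.isMaximal inferInstance hP0
  have hover : P.LiesOver (maximalIdeal V) :=
    ⟨(eq_maximalIdeal (Ideal.IsMaximal.under V P)).symm⟩
  have hsep : Algebra.IsSeparable (V ⧸ maximalIdeal V) (W ⧸ P) := by
    refine isSeparable_residueField_of_not_dvd (G := G) (maximalIdeal V) P p ?_
      (not_dvd_card_of_faithful (V := V) hζ hfaith)
    rw [hpπ]
    exact Ideal.mul_mem_left _ _ (Ideal.pow_mem_of_mem _
      ((mem_maximalIdeal π).mpr hπ.not_isUnit) _ (Nat.pos_of_ne_zero he0))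
  obtain ⟨σ, ϖ, θ, w₁, w₂, a, r, l, m, k, hPϖ, hσP, hσζ, har, hσϖ, hθ, hζ1, hw₁, hpk, hw₂⟩ :=
    exists_inertia_generator hπ hw he0 he hpπ hζ hfaith P hπP
  -- The commuting automorphisms of `R ⊗ W` and of its localization `S` at `𝔓`.
  let gA := Algebra.TensorProduct.map (MulSemiringAction.toAlgHom V R g) (AlgHom.id V W)
  let σA := Algebra.TensorProduct.map (AlgHom.id V R) (MulSemiringAction.toAlgHom V W σ)
  let gB : R ⊗[V] W →+* R ⊗[V] W := gA.toRingHom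
  let σB : R ⊗[V] W →+* R ⊗[V] W := σA.toRingHom
  have hgB : ∀ x, gB x - x ∈ 𝔓 := TensorProduct.map_sub_mem _ _ 𝔓
    (fun r => (hmem𝔓 _).mpr (hg r)) (fun x => by simp)
  have hσI : ∀ x, σB x - x ∈ P.map incl := TensorProduct.map_sub_mem _ _ _ (fun r => by simp)
    (fun x => Ideal.mem_map_of_mem incl (hσP x))
  have hσB : ∀ x, σB x - x ∈ 𝔓 := fun x => Ideal.map_comap_le (hσI x)
  have hgBp : ∀ x, gB^[p] x = x := by
    intro x
    change (gA)^[p] x = x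
    rw [map_toAlgHom_iterate, ← hord, pow_orderOf_eq_one, map_toAlgHom_one]
  have hcomm : ∀ x, σB (gB x) = gB (σB x) := by
    intro x
    induction x with
    | zero => simp
    | add x y hx hy => rw [map_add, map_add, hx, hy, map_add, map_add]
    | tmul r x => rfl
  let S := Localization.AtPrime 𝔓
  let gS : S →+* S := inertialMap 𝔓 gB hgB
  let σS : S →+* S := inertialMap 𝔓 σB hσB
  have hgSp : ∀ s, gS^[p] s = s := inertialMap_iterate_eq_self hgB hgBp
  have hgS : ∀ x, gS (algebraMap _ S x) = algebraMap _ S (gB x) := inertialMap_algebraMap hgB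
  have hσS : ∀ x, σS (algebraMap _ S x) = algebraMap _ S (σB x) := inertialMap_algebraMap hσB
  have hcommS : ∀ s, σS (gS s) = gS (σS s) := by
    have : σS.comp gS = gS.comp σS := by
      refine IsLocalization.ringHom_ext 𝔓.primeCompl (RingHom.ext fun x => ?_)
      rw [RingHom.comp_apply, RingHom.comp_apply, RingHom.comp_apply, RingHom.comp_apply, hgS, hσS,
        hσS, hgS, hcomm]
    exact fun s => RingHom.congr_fun this s
  let ι : W →+* S := (algebraMap (R ⊗[V] W) S).comp incl.toRingHom
  have hι : ∀ x, ι x = algebraMap (R ⊗[V] W) S (1 ⊗ₜ x) := fun _ => rfl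
  have hgι : ∀ x, gS (ι x) = ι x := fun x => by
    rw [hι, inertialMap_algebraMap]
    congr 1
    change gA _ = _
    simp [gA]
  have hσι : ∀ x, σS (ι x) = ι (σ • x) := fun x => by
    rw [hι, hι, inertialMap_algebraMap]
    rfl
  have hunit : ∀ x, x ∉ P → IsUnit (ι x) := fun x hx =>
    IsLocalization.map_units S (⟨1 ⊗ₜ x, hx⟩ : 𝔓.primeCompl)
  have hϖm : ι ϖ ∈ maximalIdeal S := by
    rw [← Localization.AtPrime.map_eq_maximalIdeal]
    refine Ideal.mem_map_of_mem _ ?_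
    have : ϖ ∈ P := hPϖ ▸ Ideal.mem_span_singleton_self ϖ
    exact this
  have hPS : (P.map incl).map (algebraMap (R ⊗[V] W) S) = Ideal.span {ι ϖ} := by
    rw [hPϖ, Ideal.map_span, Ideal.map_span, Set.image_singleton, Set.image_singleton]
    rfl
  -- The element `ϖ` is a nonzerodivisor because it divides `π`, and `W / V` is free.
  have hϖ : ∀ s, ι ϖ * s = 0 → s = 0 := by
    have hB : ∀ x : R ⊗[V] W, (1 : R) ⊗ₜ[V] ϖ * x = 0 → x = 0 := by
      intro x hx
      obtain ⟨c, hc⟩ : ϖ ∣ algebraMap V W π := by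
        rw [← Ideal.mem_span_singleton, ← hPϖ]
        exact hπP
      let bB := Algebra.TensorProduct.basis R (Module.Free.chooseBasis V W)
      have h1 : algebraMap V R π • x = 0 := by
        have h2 : algebraMap R (R ⊗[V] W) (algebraMap V R π) = 1 ⊗ₜ[V] c * 1 ⊗ₜ[V] ϖ := by
          rw [← IsScalarTower.algebraMap_apply, ← AlgHom.commutes incl, hc, mul_comm, map_mul]
          rfl
        rw [Algebra.smul_def, h2, mul_assoc, hx, mul_zero]
      refine bB.ext_elem fun i => ?_
      have h2 := congrArg (fun y => bB.repr y i) h1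
      simp only [map_smul, Finsupp.smul_apply, smul_eq_mul, map_zero, Finsupp.zero_apply] at h2 ⊢
      exact hR.eq_zero_of_algebraMap_mul_eq_zero hπ h2
    have h1 : ι ϖ ∈ nonZeroDivisors S :=
      IsLocalization.map_nonZeroDivisors_le 𝔓.primeCompl S
        ⟨_, mem_nonZeroDivisors_iff_left.mpr hB, rfl⟩
    exact fun s hs => (mul_left_mem_nonZeroDivisors_eq_zero_iff h1).mp hs
  have hrad : (Ideal.span {ι ϖ}).IsRadical := by
    rw [← hPS]
    refine Ideal.IsRadical.map_localization ?_ 𝔓.primeCompl S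
    refine isRadical_map_includeRight (maximalIdeal V) P ?_
    rw [hπ.maximalIdeal_eq, Ideal.map_span, Set.image_singleton]
    exact hR.isRadical_span_algebraMap hπ
  have hpS : (p : S) = ι w₂ * ι ϖ ^ k := by
    rw [← map_natCast ι, hpk, map_mul, map_pow]
  obtain ⟨v, hv⟩ := (hunit w₂ hw₂).exists_right_inv
  -- Away from `p`, the powers of `g` are distinct at every point.
  have hdist : ∀ Q : Ideal S, Q.IsPrime → (p : S) ∉ Q →
      ∀ i j, i < j → j < p → ∃ b, gS^[i] b - gS^[j] b ∉ Q := by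
    intro Q hQ hpQ i j hij hj
    by_contra! h
    let j' : R →+* S := (algebraMap (R ⊗[V] W) S).comp
      (Algebra.TensorProduct.includeLeft : R →ₐ[V] R ⊗[V] W).toRingHom
    have hj' : ∀ n x, gS^[n] (j' x) = j' (g ^ n • x) := by
      intro n x
      induction n with
      | zero => simp
      | succ n ih =>
        rw [Function.iterate_succ_apply', ih, pow_succ', mul_smul]
        change gS (algebraMap (R ⊗[V] W) S _) = _
        rw [inertialMap_algebraMap]
        rfl
    have h1 := hfree (Q.comap j') inferInstance
      (fun h => hpQ (by rwa [Ideal.mem_comap, map_natCast] at h)) (g ^ (j - i)) (fun x => by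
        have h2 := Q.neg_mem (h (j' ((g ^ i)⁻¹ • x)))
        rwa [hj', hj', ← map_sub, ← map_neg, neg_sub, smul_inv_smul, ← mul_smul, ← pow_sub _ hij.le]
          at h2)
    have h2 := orderOf_dvd_of_pow_eq_one h1
    rw [hord] at h2
    exact absurd (Nat.le_of_dvd (by omega) h2) (by omega)
  have hres : ∀ z : S, ∃ N, ι ϖ ^ N ∈ Ideal.span (Set.range (lagrangeResolvent gS p z)) := by
    intro z
    obtain ⟨n, hn⟩ := mem_radical_span_range_lagrangeResolvent hp.out.ne_zero z hdist
    refine ⟨k * n, ?_⟩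
    have h1 : ι ϖ ^ (k * n) = v ^ n * (p : S) ^ n := by
      rw [← mul_pow, hpS, ← mul_assoc, mul_comm v, hv, one_mul, pow_mul]
    rw [h1]
    exact Ideal.mul_mem_left _ _ hn
  have hζp : ι ζ ^ p = 1 := by rw [← map_pow, hζ.pow_eq_one, map_one]
  obtain ⟨N, hN⟩ := hres (ι ζ)
  obtain ⟨N', hN'⟩ := hres (ι ζ ^ (p - 1))
  let _ : Algebra (FixedPoints.subalgebra V R C ⊗[V] W) (R ⊗[V] W) :=
    (Algebra.TensorProduct.map (FixedPoints.subalgebra V R C).val (AlgHom.id V W)).toAlgebra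
  obtain ⟨hdom, hufm⟩ := isDomain_and_uniqueFactorizationMonoid_eqLocus
    (A := FixedPoints.subalgebra V R C ⊗[V] W) 𝔓 hgB hp.out.ne_zero hgBp
    (Module.Flat.rTensor_preserves_injective_linearMap
      (FixedPoints.subalgebra V R C).val.toLinearMap Subtype.val_injective)
    (map_toAlgHom_eq_self_iff hgen) hfac
  obtain ⟨y, hy, hgy⟩ := exists_isUnit_eigenvector (T := gS.eqLocus (RingHom.id S))
    (ζ := ι ζ) (η := ι ζ ^ (p - 1)) (N := N + N')
    (fun s => Iff.rfl) hgSp hp.out.ne_zero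
    (by rw [← pow_succ', Nat.sub_add_cancel hp.out.one_le, hζp]) (hgι ζ) hζp (hgι ϖ) hϖ hrad hpS hv
    (by rw [pow_add]; exact Ideal.mul_mem_right _ _ hN)
    (by rw [pow_add]; exact Ideal.mul_mem_left _ _ hN')
  obtain ⟨z, hz⟩ := exists_isUnit_map_sub (g := gS) (σ := σS) hcommS
    (by rw [hσι, hσζ, map_pow]) har hζp (hgι ϖ) hϖ hϖm
    (by rw [hσι, hσϖ, map_mul]) (hgι θ)
    (fun s => by
      rw [← Ideal.mem_span_singleton, ← hPS]
      exact inertialMap_sub_mem_map hσB _ hσI s)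
    (fun j hj0 hjm => by
      have := hunit _ (hθ j hj0 hjm)
      rwa [map_sub, map_pow, map_natCast] at this)
    (by rw [← map_one ι, ← map_sub, hζ1, map_mul, map_pow]) (hunit w₁ hw₁) hy.unit hgy
  exact inertialMap_sub_mem_maximalIdeal hgB z hz

end Main

theorem proposition3p4p5p1
    (p : ℕ) [Fact p.Prime]
    (V : Type*) [CommRing V] [IsDomain V] [IsDiscreteValuationRing V]
    [IsAdicComplete (IsLocalRing.maximalIdeal V) V]
    [Algebra (ZLocalizedAt p) V] [Module.FaithfullyFlat (ZLocalizedAt p) V]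
    (he : (IsLocalRing.maximalIdeal V).ramificationIdx (ZLocalizedAt p) < p - 1)
    (R : Type*) [CommRing R] [Algebra V R] [IsRegularRing R]
    (hR : IsPointwiseFormallySmooth V R)
    (C : Type*) [Group C] [Finite C] [MulSemiringAction C R] [SMulCommClass C V R]
    (hfree : letI := awayAction C R p
      ActsFreely C (Localization.Away (p : R)))
    (hC : (Nat.card C).Coprime p ∨
      (Nat.card C = p ∧
        IsLocallyFactorial (FixedPoints.subalgebra V R C ⊗[V] AdjoinRootOfUnity V p))) :
    ActsFreely C R := by
  intro 𝔭 h𝔭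
  refine (Subgroup.eq_bot_iff_forall _).mpr fun g hg => ?_
  have hg' : ∀ x : R, g • x - x ∈ 𝔭 := hg
  by_cases hp𝔭 : (p : R) ∈ 𝔭
  · obtain ⟨π, w, hπ, hw, he0, hpπ⟩ := exists_natCast_eq_mul_pow p V
    have hπ𝔭 : algebraMap V R π ∈ 𝔭 := by
      rw [← map_natCast (algebraMap V R), hpπ, map_mul, map_pow] at hp𝔭
      exact h𝔭.mem_of_pow_mem _ ((Ideal.unit_mul_mem_iff_mem _ (hw.map _)).mp hp𝔭)
    rcases hC with hC | ⟨hC, hfac⟩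
    · have hord : ((orderOf g : ℕ) : R) ∉ 𝔭 := by
        intro h
        have hcop : (orderOf g).Coprime p := hC.coprime_dvd_left (orderOf_dvd_natCard g)
        have h1 := congrArg (Int.cast : ℤ → R) (Int.gcd_eq_gcd_ab (orderOf g) p)
        rw [Int.gcd_natCast_natCast, hcop] at h1
        push_cast at h1
        refine h𝔭.ne_top ((Ideal.eq_top_iff_one _).mpr ?_)
        rw [h1]
        exact 𝔭.add_mem (𝔭.mul_mem_right _ h) (𝔭.mul_mem_right _ hp𝔭)
      obtain ⟨𝔮, h𝔮, hp𝔮, hg𝔮⟩ :=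
        hR.exists_prime_forall_smul_sub_mem hπ hw hpπ 𝔭 hπ𝔭 hg' hord
      exact ActsFreely.eq_one_of_forall_smul_sub_mem hfree hp𝔮 hg𝔮
    · have := charZero_of_faithfullyFlat p V
      have := finite_adjoinRootOfUnity p V
      have := isDedekindDomain_adjoinRootOfUnity p V
      have := isGaloisGroup_adjoinRootOfUnity p V
      have := charZero_fractionRing V
      have : FiniteDimensional (FractionRing V) (CyclotomicField p (FractionRing V)) :=
        IsCyclotomicExtension.finiteDimensional {p} _ _
      obtain ⟨ζ, hζ, hfaith⟩ := exists_isPrimitiveRoot_adjoinRootOfUnity p V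
      exact hR.eq_one_of_card_eq hπ hw he0 he hpπ hζ hfaith hC
        (fun 𝔮 _ hp𝔮 g hg => ActsFreely.eq_one_of_forall_smul_sub_mem hfree hp𝔮 hg) hfac 𝔭 hπ𝔭 hg'
  · exact ActsFreely.eq_one_of_forall_smul_sub_mem hfree hp𝔭 hg'
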